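/- Let $k$ be an arbitrary field. An endomorphism of $\mathbb{A}^n=\mathbb{A}^n_k$ ($n\ge 1$) is a tuple $f=(f_1,\dots,f_n)$ with $f_i\in k[x_1,\dots,x_n]$; its degree is $\deg f=\max_i\deg f_i$, and it is an automorphism if it is invertible under composition. An automorphism $f$ of $\mathbb{A}^n$ is called affine-triangular if $f=\alpha\circ\tau$, where $\alpha$ is an affine automorphism (an automorphism of degree $1$) and $\tau=(\tau_1,\dots,\tau_n)$ is triangular, i.e. $\tau_i\in k[x_1,\dots,x_i]$ for every $i$. The dynamical degree of $f$ is $\lambda(f)=\lim_{r\to\infty}\deg(f^r)^{1/r}$. A weak Perron number is a real algebraic integer $\lambda\ge 1$ such that all other Galois conjugates $\mu\in\mathbb{C}$ of $\lambda$ satisfy $|\mu|\le\lambda$. Theorem. Each weak Perron number $\lambda$ is the dynamical degree of an affine-triangular automorphism of $\mathbb{A}^n$ over $k$ for some integer $n\ge 1$. Moreover: 1. If $\lambda>1$ is an integer, the least possible $n$ is $2$. 2. If $\lambda$ is a quadratic integer (an algebraic integer of degree $2$ over $\mathbb{Q}$) and its Galois conjugate is negative, the least possible $n$ is $3$. 3.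 If $\lambda$ is a quadratic integer and its Galois conjugate is positive, the least possible $n$ is $4$. -/

import Mathlib

namespace AffineDyn

/-- Endomorphisms of affine `n`-space over `k`, as `n`-tuples of polynomials in `n` variables. -/
abbrev PolyEnd (k : Type*) [Field k] (n : ℕ) : Type _ :=
  Fin n → MvPolynomial (Fin n) k

namespace PolyEnd

variable {k : Type*} [Field k] {n : ℕ}

/-- The identity `(x₁, …, xₙ)`. -/
noncomputable def one (k : Type*) [Field k] (n : ℕ) : PolyEnd k n :=
  fun i => MvPolynomial.X i

/-- The composition `f ∘ g`, with components `fᵢ(g₁, …, gₙ)`. -/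
noncomputable def comp (f g : PolyEnd k n) : PolyEnd k n :=
  fun i => MvPolynomial.bind₁ g (f i)

/-- The `r`-fold composition of `f` with itself. -/
noncomputable def iter (f : PolyEnd k n) : ℕ → PolyEnd k n
  | 0 => one k n
  | r + 1 => comp f (iter f r)

/-- The maximum of the degrees of the components. -/
noncomputable def degree (f : PolyEnd k n) : ℕ :=
  Finset.univ.sup fun i => (f i).totalDegree

/-- `f` is invertible for the composition. -/
def IsAut (f : PolyEnd k n) : Prop :=
  ∃ g : PolyEnd k n, comp f g = one k n ∧ comp g f = one k n

/-- `fᵢ ∈ k[x₁, …, xᵢ]` for each `i`. -/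
def IsTriangular (f : PolyEnd k n) : Prop :=
  ∀ i, f i ∈ MvPolynomial.supported k (Set.Iic i)

/-- Affine automorphisms: the automorphisms of degree `1`. -/
def IsAffineAut (f : PolyEnd k n) : Prop :=
  IsAut f ∧ degree f = 1

/-- `f = α ∘ τ` with `α` an affine automorphism and `τ` a triangular endomorphism. -/
def IsAffineTriangular (f : PolyEnd k n) : Prop :=
  ∃ α τ : PolyEnd k n, IsAffineAut α ∧ IsTriangular τ ∧ f = comp α τ

/-- The dynamical degree of `f` exists and equals `l`: `deg(f^r)^(1/r) → l` as `r → ∞`. -/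
def HasDynamicalDegree (f : PolyEnd k n) (l : ℝ) : Prop :=
  Filter.Tendsto (fun r : ℕ => ((iter f r).degree : ℝ) ^ (1 / (r : ℝ)))
    Filter.atTop (nhds l)

end PolyEnd

/-- The set of `n ≥ 1` such that `l` is the dynamical degree of an affine-triangular
automorphism of affine `n`-space over `k`. -/
def realizingDims (k : Type*) [Field k] (l : ℝ) : Set ℕ :=
  {n | 1 ≤ n ∧ ∃ f : PolyEnd k n, f.IsAut ∧ f.IsAffineTriangular ∧ f.HasDynamicalDegree l}

/-- `μ ∈ ℂ` is a Galois conjugate (over `ℚ`) of the algebraic real number `l`. -/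
def IsConjugateOf (μ : ℂ) (l : ℝ) : Prop :=
  Polynomial.aeval μ (minpoly ℚ l) = 0

/-- A real algebraic integer `l ≥ 1` all of whose other Galois conjugates `μ ∈ ℂ` satisfy
`|μ| ≤ l`. -/
def IsWeakPerron (l : ℝ) : Prop :=
  1 ≤ l ∧ IsIntegral ℤ l ∧ ∀ μ : ℂ, IsConjugateOf μ l → μ ≠ (l : ℂ) → ‖μ‖ ≤ l

/-- An algebraic integer of degree `2` over `ℚ`. -/
def IsQuadraticInteger (l : ℝ) : Prop :=
  IsIntegral ℤ l ∧ (minpoly ℚ l).natDegree = 2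

end AffineDyn

/-! Degrees are controlled by real weights `w` on the variables. If every `f i` has weight at most
`t * w i` with `w` positive, the degree of `f^r` is at most a constant times `t ^ r`
(`exists_degree_iter_le`). Conversely, if the parts of weight exactly `t * w i` form an endomorphism
whose iterates keep a nonzero component of positive weight, nothing cancels at the top and the
degree is at least a constant times `t ^ r` (`exists_le_degree_iter`).

Existence. A weak Perron number `l` is the eigenvalue, with a positive eigenvector `u`, of a
nonnegative integer matrix (`IsWeakPerron.exists_matrix`): the conjugates of modulus `l` have a
common power `l ^ m`, so `l ^ m` strictly dominates its other conjugates, and multiplication by it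
preserves a finitely generated semigroup of positive elements. Taking the rows of the matrix as
exponents of monomials and `u` as weights gives an affine-triangular automorphism in twice as many
variables, with monomial leading part (`add_self_mem_realizingDims`).

Lower bounds on the dimension. A Bruhat-type reduction conjugates an affine-triangular automorphism
to a triangular one followed by a permutation of the coordinates (`IsAffineTriangular.exists_conj`),
and the permutations are treated one by one. If the dynamical degree `l` exceeds 1, then `n = 1` is
impossible, `n = 2` makes `l` an integer, and `n = 3` gives `l ^ 2 = i * l + j` with natural `i`,
`j` (`dynamicalDegree_of_dim_three`). For a quadratic integer the last equation makes the product of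
the two conjugates equal to `-j`, which excludes a positive conjugate. Explicit maps in dimensions
2, 3 and 4 show that these bounds are attained. -/

namespace AffineDyn

open MvPolynomial

/-! ### Composition and conjugation of endomorphisms. -/

namespace PolyEnd

variable {k : Type*} [Field k] {n : ℕ}

theorem comp_assoc (f g h : PolyEnd k n) : comp (comp f g) h = comp f (comp g h) := by
  funext i
  simp only [comp, bind₁_bind₁]
  rfl

@[simp]
theorem one_comp (f : PolyEnd k n) : comp (one k n) f = f := by
  funext i
  simp [comp, one]

@[simp]
theorem comp_one (f : PolyEnd k n) : comp f (one k n) = f := by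
  funext i
  exact congrArg (fun φ : MvPolynomial (Fin n) k →ₐ[k] _ => φ (f i)) bind₁_X_left

theorem IsAut.comp {f g : PolyEnd k n} (hf : IsAut f) (hg : IsAut g) :
    IsAut (PolyEnd.comp f g) := by
  obtain ⟨f', h1, h2⟩ := hf
  obtain ⟨g', h3, h4⟩ := hg
  refine ⟨PolyEnd.comp g' f', ?_, ?_⟩
  · rw [comp_assoc, ← comp_assoc g, h3, one_comp, h1]
  · rw [comp_assoc, ← comp_assoc f', h2, one_comp, h4]

theorem comp_conj_iter {f φ ψ : PolyEnd k n} (h : comp ψ φ = one k n) (h' : comp φ ψ = one k n)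
    (r : ℕ) : iter (comp φ (comp f ψ)) r = comp φ (comp (iter f r) ψ) := by
  induction r with
  | zero => simp [iter, h']
  | succ r ih =>
    rw [iter, ih, iter]
    simp only [comp_assoc]
    rw [← comp_assoc ψ φ, h, one_comp]

theorem bind₁_bind₁_of_comp {τ g : PolyEnd k n} (h : comp τ g = one k n)
    (p : MvPolynomial (Fin n) k) : bind₁ g (bind₁ τ p) = p := by
  have h2 := congrArg (fun g : PolyEnd k n => bind₁ g p) h
  rw [bind₁_bind₁]
  refine h2.trans ?_
  exact congrArg (fun φ : MvPolynomial (Fin n) k →ₐ[k] _ => φ p) bind₁_X_left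

end PolyEnd

/-! ### Weights and leading parts. -/

section Weights

variable {k : Type*} [Field k] {σ σ' : Type*}

/-- The polynomials all of whose monomials have `w`-weight in `S`. -/
noncomputable def weightSub (k : Type*) [Field k] (w : σ → ℝ) (S : Set ℝ) :
    Submodule k (MvPolynomial σ k) :=
  restrictSupport k {d | Finsupp.weight w d ∈ S}

theorem mem_weightSub {w : σ → ℝ} {S : Set ℝ} {p : MvPolynomial σ k} :
    p ∈ weightSub k w S ↔ ∀ d, coeff d p ≠ 0 → Finsupp.weight w d ∈ S := by
  rw [weightSub, mem_restrictSupport_iff]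
  simp [Set.subset_def]

theorem weightSub_mono {w : σ → ℝ} {S T : Set ℝ} (h : S ⊆ T) :
    weightSub k w S ≤ weightSub k w T :=
  restrictSupport_mono _ fun _ hd => h hd

theorem monomial_mem_weightSub {w : σ → ℝ} {S : Set ℝ} {d : σ →₀ ℕ} (c : k)
    (h : Finsupp.weight w d ∈ S) : monomial d c ∈ weightSub k w S :=
  (monomial_mem_restrictSupport _).2 (Or.inl h)

theorem X_mem_weightSub {w : σ → ℝ} {S : Set ℝ} {i : σ} (h : w i ∈ S) :
    (X i : MvPolynomial σ k) ∈ weightSub k w S :=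
  monomial_mem_weightSub _ (by simpa [Finsupp.weight_single] using h)

theorem C_mem_weightSub {w : σ → ℝ} {S : Set ℝ} (c : k) (h : (0 : ℝ) ∈ S) :
    (C c : MvPolynomial σ k) ∈ weightSub k w S :=
  monomial_mem_weightSub _ (by simpa using h)

theorem mul_mem_weightSub {w : σ → ℝ} {S T U : Set ℝ} {p q : MvPolynomial σ k}
    (hp : p ∈ weightSub k w S) (hq : q ∈ weightSub k w T)
    (h : ∀ a ∈ S, ∀ b ∈ T, a + b ∈ U) : p * q ∈ weightSub k w U := by
  classical
  rw [mem_weightSub] at *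
  intro d hd
  rw [coeff_mul] at hd
  obtain ⟨x, hx, hne⟩ := Finset.exists_ne_zero_of_sum_ne_zero hd
  rw [← Finset.HasAntidiagonal.mem_antidiagonal.1 hx, map_add]
  exact h _ (hp _ (left_ne_zero_of_mul hne)) _ (hq _ (right_ne_zero_of_mul hne))

/-- `p = L + (terms of weight less than D)` with `L` homogeneous of weight `D`. -/
structure HasLead (w : σ → ℝ) (D : ℝ) (p L : MvPolynomial σ k) : Prop where
  lead : L ∈ weightSub k w {D}
  rest : p - L ∈ weightSub k w (Set.Iio D)

theorem HasLead.mem_Iic {w : σ → ℝ} {D : ℝ} {p L : MvPolynomial σ k} (h : HasLead w D p L) :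
    p ∈ weightSub k w (Set.Iic D) := by
  have h1 := weightSub_mono (T := Set.Iic D) (by simp) h.lead
  have h2 := weightSub_mono (T := Set.Iic D) Set.Iio_subset_Iic_self h.rest
  simpa using Submodule.add_mem _ h2 h1

theorem HasLead.mul {w : σ → ℝ} {D E : ℝ} {p L q M : MvPolynomial σ k} (h : HasLead w D p L)
    (h' : HasLead w E q M) : HasLead w (D + E) (p * q) (L * M) where
  lead := mul_mem_weightSub h.lead h'.lead (by simp)
  rest := by
    have e : p * q - L * M = (p - L) * q + L * (q - M) := by ring
    rw [e]
    refine Submodule.add_mem _ (mul_mem_weightSub h.rest h'.mem_Iic ?_)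
      (mul_mem_weightSub h.lead h'.rest ?_)
    · intro a ha b hb
      exact add_lt_add_of_lt_of_le (Set.mem_Iio.1 ha) (Set.mem_Iic.1 hb)
    · intro a ha b hb
      exact add_lt_add_of_le_of_lt (le_of_eq (Set.mem_singleton_iff.1 ha)) (Set.mem_Iio.1 hb)

theorem HasLead.one (w : σ → ℝ) : HasLead w 0 (1 : MvPolynomial σ k) 1 where
  lead := C_mem_weightSub 1 (by simp)
  rest := by simp

theorem HasLead.pow {w : σ → ℝ} {D : ℝ} {p L : MvPolynomial σ k} (h : HasLead w D p L) (m : ℕ) :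
    HasLead w (m * D) (p ^ m) (L ^ m) := by
  induction m with
  | zero => simpa using HasLead.one w
  | succ m ih =>
    rw [pow_succ, pow_succ]
    convert ih.mul h using 1
    push_cast
    ring

theorem HasLead.prod {ι : Type*} {w : σ → ℝ} (s : Finset ι) {D : ι → ℝ}
    {p L : ι → MvPolynomial σ k} (h : ∀ i, HasLead w (D i) (p i) (L i)) :
    HasLead w (∑ i ∈ s, D i) (∏ i ∈ s, p i) (∏ i ∈ s, L i) := by
  classical
  induction s using Finset.induction_on with
  | empty => simpa using HasLead.one w
  | insert a s ha ih =>
    rw [Finset.sum_insert ha, Finset.prod_insert ha, Finset.prod_insert ha]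
    exact (h a).mul ih

theorem weight_scale (w : σ → ℝ) (D : ℝ) (d : σ →₀ ℕ) :
    ∑ i ∈ d.support, (d i : ℝ) * (D * w i) = D * Finsupp.weight w d := by
  simp only [Finsupp.weight_apply, Finsupp.sum, nsmul_eq_mul, Finset.mul_sum]
  exact Finset.sum_congr rfl fun _ _ => by ring

theorem bind₁_eq_sum (g : σ → MvPolynomial σ' k) (p : MvPolynomial σ k) :
    bind₁ g p = ∑ d ∈ p.support, C (coeff d p) * ∏ i ∈ d.support, g i ^ d i := by
  conv_lhs => rw [p.as_sum, map_sum]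
  exact Finset.sum_congr rfl fun d _ => bind₁_monomial _ _ _

/-- Substitution multiplies weights by `D`: a monomial of weight `e` becomes a polynomial of weight
at most `D * e` whose top part is the same monomial in the `g' i`. As `D > 0`, the lower terms of
`p` stay strictly below `D * E`. -/
theorem bind₁_hasLead {w : σ → ℝ} {w' : σ' → ℝ} {D E : ℝ} (hD : 0 < D)
    {g g' : σ → MvPolynomial σ' k} {p L : MvPolynomial σ k}
    (hg : ∀ i, HasLead w' (D * w i) (g i) (g' i)) (hp : HasLead w E p L) :
    HasLead w' (D * E) (bind₁ g p) (bind₁ g' L) := by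
  have key (d : σ →₀ ℕ) : HasLead w' (D * Finsupp.weight w d)
      (∏ i ∈ d.support, g i ^ d i) (∏ i ∈ d.support, g' i ^ d i) := by
    rw [← weight_scale]
    exact HasLead.prod _ fun i => (hg i).pow (d i)
  refine ⟨?_, ?_⟩
  · rw [bind₁_eq_sum]
    refine Submodule.sum_mem _ fun d hd => ?_
    rw [← smul_eq_C_mul]
    refine Submodule.smul_mem _ _ ?_
    have := (mem_weightSub.1 hp.lead) d (mem_support_iff.1 hd)
    rw [← Set.mem_singleton_iff.1 this]
    exact (key d).lead
  · have e : bind₁ g p - bind₁ g' L = bind₁ g (p - L) + (bind₁ g L - bind₁ g' L) := by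
      rw [map_sub]
      ring
    rw [e]
    refine Submodule.add_mem _ ?_ ?_
    · rw [bind₁_eq_sum]
      refine Submodule.sum_mem _ fun d hd => ?_
      rw [← smul_eq_C_mul]
      refine Submodule.smul_mem _ _ ?_
      have : Finsupp.weight w d < E := (mem_weightSub.1 hp.rest) d (mem_support_iff.1 hd)
      exact weightSub_mono (Set.Iic_subset_Iio.2 (mul_lt_mul_of_pos_left this hD)) (key d).mem_Iic
    · rw [bind₁_eq_sum, bind₁_eq_sum, ← Finset.sum_sub_distrib]
      refine Submodule.sum_mem _ fun d hd => ?_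
      rw [← mul_sub, ← smul_eq_C_mul]
      refine Submodule.smul_mem _ _ ?_
      have := (mem_weightSub.1 hp.lead) d (mem_support_iff.1 hd)
      rw [← Set.mem_singleton_iff.1 this]
      exact (key d).rest

theorem prod_pow_mem_Iic {w : σ → ℝ} {w' : σ' → ℝ} {D : ℝ} {g : σ → MvPolynomial σ' k}
    (hg : ∀ i, g i ∈ weightSub k w' (Set.Iic (D * w i))) (d : σ →₀ ℕ) :
    ∏ i ∈ d.support, g i ^ d i ∈ weightSub k w' (Set.Iic (D * Finsupp.weight w d)) := by
  classical
  rw [← weight_scale]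
  induction d.support using Finset.induction_on with
  | empty => exact C_mem_weightSub 1 (by simp)
  | insert a s ha ih =>
    rw [Finset.sum_insert ha, Finset.prod_insert ha]
    refine mul_mem_weightSub (S := Set.Iic (d a * (D * w a))) ?_ ih
      fun x hx y hy => Set.mem_Iic.2 (add_le_add (Set.mem_Iic.1 hx) (Set.mem_Iic.1 hy))
    induction d a with
    | zero => simpa using C_mem_weightSub (k := k) 1 (by simp)
    | succ m ihm =>
      rw [pow_succ]
      refine mul_mem_weightSub ihm (hg a) fun x hx y hy => ?_
      have := add_le_add (Set.mem_Iic.1 hx) (Set.mem_Iic.1 hy)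
      rw [Set.mem_Iic]
      push_cast
      linarith

theorem bind₁_mem_Iic {w : σ → ℝ} {w' : σ' → ℝ} {D E : ℝ} (hD : 0 ≤ D)
    {g : σ → MvPolynomial σ' k} {p : MvPolynomial σ k}
    (hg : ∀ i, g i ∈ weightSub k w' (Set.Iic (D * w i))) (hp : p ∈ weightSub k w (Set.Iic E)) :
    bind₁ g p ∈ weightSub k w' (Set.Iic (D * E)) := by
  rw [bind₁_eq_sum]
  refine Submodule.sum_mem _ fun d hd => ?_
  rw [← smul_eq_C_mul]
  refine Submodule.smul_mem _ _ ?_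
  have : Finsupp.weight w d ≤ E := (mem_weightSub.1 hp) d (mem_support_iff.1 hd)
  exact weightSub_mono (Set.Iic_subset_Iic.2 (mul_le_mul_of_nonneg_left this hD))
    (prod_pow_mem_Iic hg d)

theorem weight_one_eq_degree (d : σ →₀ ℕ) :
    Finsupp.weight (fun _ => (1 : ℝ)) d = ((d.sum fun _ e => e : ℕ) : ℝ) := by
  simp [Finsupp.weight_apply, Finsupp.sum]

theorem mem_weightSub_one_iff {p : MvPolynomial σ k} {N : ℕ} :
    p ∈ weightSub k (fun _ => (1 : ℝ)) (Set.Iic (N : ℝ)) ↔ p.totalDegree ≤ N := by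
  rw [mem_weightSub, totalDegree, Finset.sup_le_iff]
  simp only [weight_one_eq_degree, Set.mem_Iic, Nat.cast_le, mem_support_iff]

theorem mul_degree_le_weight {w : σ → ℝ} {δ : ℝ} (hw : ∀ i, δ ≤ w i) (d : σ →₀ ℕ) :
    δ * ((d.sum fun _ e => e : ℕ) : ℝ) ≤ Finsupp.weight w d := by
  simp only [Finsupp.weight_apply, Finsupp.sum, nsmul_eq_mul, Nat.cast_sum, Finset.mul_sum]
  exact Finset.sum_le_sum fun i _ => by nlinarith [hw i, Nat.cast_nonneg (α := ℝ) (d i)]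

theorem weight_le_mul_degree {w : σ → ℝ} {B : ℝ} (hw : ∀ i, w i ≤ B) (d : σ →₀ ℕ) :
    Finsupp.weight w d ≤ B * ((d.sum fun _ e => e : ℕ) : ℝ) := by
  simp only [Finsupp.weight_apply, Finsupp.sum, nsmul_eq_mul, Nat.cast_sum, Finset.mul_sum]
  exact Finset.sum_le_sum fun i _ => by nlinarith [hw i, Nat.cast_nonneg (α := ℝ) (d i)]

theorem totalDegree_le_of_mem_Iic {w : σ → ℝ} {δ E : ℝ} (hδ : 0 < δ) (hw : ∀ i, δ ≤ w i)
    (hE : 0 ≤ E) {p : MvPolynomial σ k} (hp : p ∈ weightSub k w (Set.Iic E)) :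
    (p.totalDegree : ℝ) ≤ E / δ := by
  have : p.totalDegree ≤ ⌊E / δ⌋₊ := by
    refine Finset.sup_le fun d hd => Nat.le_floor ?_
    rw [le_div_iff₀ hδ, mul_comm]
    exact (mul_degree_le_weight hw d).trans ((mem_weightSub.1 hp) d (mem_support_iff.1 hd))
  exact (Nat.cast_le.2 this).trans (Nat.floor_le (by positivity))

theorem HasLead.le_mul_totalDegree {w : σ → ℝ} {B D : ℝ} (hB : 0 ≤ B) (hw : ∀ i, w i ≤ B)
    {p L : MvPolynomial σ k} (h : HasLead w D p L) (hL : L ≠ 0) :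
    D ≤ B * p.totalDegree := by
  obtain ⟨d, hd⟩ := ne_zero_iff.1 hL
  have h1 : Finsupp.weight w d = D := (mem_weightSub.1 h.lead) d hd
  have h2 : coeff d p ≠ 0 := by
    intro h0
    have := (mem_weightSub.1 h.rest) d (by simpa [h0] using hd)
    rw [h1] at this
    exact lt_irrefl _ (Set.mem_Iio.1 this)
  rw [← h1]
  refine (weight_le_mul_degree hw d).trans (mul_le_mul_of_nonneg_left ?_ hB)
  exact Nat.cast_le.2 (le_totalDegree (mem_support_iff.2 h2))

theorem totalDegree_bind₁_le {n : ℕ} (g : PolyEnd k n) (p : MvPolynomial (Fin n) k) :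
    (bind₁ g p).totalDegree ≤ g.degree * p.totalDegree := by
  rw [← mem_weightSub_one_iff]
  push_cast
  refine bind₁_mem_Iic (w := fun _ => 1) (Nat.cast_nonneg _) (fun i => ?_)
    (mem_weightSub_one_iff.2 le_rfl)
  rw [mul_one, mem_weightSub_one_iff]
  exact Finset.le_sup (f := fun i => (g i).totalDegree) (Finset.mem_univ i)

end Weights

/-! ### Weights and the growth of degrees under iteration. -/

namespace PolyEnd

variable {k : Type*} [Field k] {n : ℕ}

theorem totalDegree_le_degree (f : PolyEnd k n) (i : Fin n) : (f i).totalDegree ≤ f.degree :=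
  Finset.le_sup (f := fun i => (f i).totalDegree) (Finset.mem_univ i)

theorem degree_comp_le (f g : PolyEnd k n) : (comp f g).degree ≤ f.degree * g.degree :=
  Finset.sup_le fun i _ => (totalDegree_bind₁_le g (f i)).trans <| by
    rw [mul_comm]
    exact Nat.mul_le_mul_right _ (totalDegree_le_degree f i)

open Filter Topology

theorem tendsto_mul_rpow_inv {C : ℝ} (hC : 0 < C) {u : ℕ → ℝ} (hu : ∀ r, 0 ≤ u r) {l : ℝ}
    (h : Tendsto (fun r : ℕ => u r ^ (1 / (r : ℝ))) atTop (𝓝 l)) :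
    Tendsto (fun r : ℕ => (C * u r) ^ (1 / (r : ℝ))) atTop (𝓝 l) := by
  have h0 : Tendsto (fun r : ℕ => C ^ (1 / (r : ℝ))) atTop (𝓝 1) := by
    have := (Real.continuous_const_rpow hC.ne').continuousAt.tendsto.comp
      (tendsto_one_div_atTop_nhds_zero_nat (𝕜 := ℝ))
    simpa [Function.comp_def] using this
  simpa [Real.mul_rpow hC.le (hu _)] using h0.mul h

theorem tendsto_mul_pow_rpow_inv {C t : ℝ} (hC : 0 < C) (ht : 0 ≤ t) :
    Tendsto (fun r : ℕ => (C * t ^ r) ^ (1 / (r : ℝ))) atTop (𝓝 t) := by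
  refine tendsto_mul_rpow_inv hC (fun r => pow_nonneg ht r) ?_
  refine tendsto_const_nhds.congr' ?_
  filter_upwards [eventually_ge_atTop 1] with r hr
  rw [one_div, Real.pow_rpow_inv_natCast ht (by omega)]

theorem rpow_inv_mono {a b : ℝ} (ha : 0 ≤ a) (h : a ≤ b) (r : ℕ) :
    a ^ (1 / (r : ℝ)) ≤ b ^ (1 / (r : ℝ)) :=
  Real.rpow_le_rpow ha h (by positivity)

theorem HasDynamicalDegree.le_of_degree_le {f : PolyEnd k n} {l C t : ℝ}
    (h : f.HasDynamicalDegree l) (hC : 0 < C) (ht : 0 ≤ t)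
    (hf : ∀ r, ((iter f r).degree : ℝ) ≤ C * t ^ r) : l ≤ t :=
  le_of_tendsto_of_tendsto' h (tendsto_mul_pow_rpow_inv hC ht) fun r =>
    rpow_inv_mono (Nat.cast_nonneg _) (hf r) r

theorem HasDynamicalDegree.le_of_le_degree {f : PolyEnd k n} {l C t : ℝ}
    (h : f.HasDynamicalDegree l) (hC : 0 < C) (ht : 0 ≤ t)
    (hf : ∀ r, C * t ^ r ≤ ((iter f r).degree : ℝ)) : t ≤ l :=
  le_of_tendsto_of_tendsto' (tendsto_mul_pow_rpow_inv hC ht) h fun r =>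
    rpow_inv_mono (by positivity) (hf r) r

theorem hasDynamicalDegree_of_bounds {f : PolyEnd k n} {C C' t : ℝ} (hC : 0 < C) (hC' : 0 < C')
    (ht : 0 ≤ t) (hf : ∀ r, C * t ^ r ≤ ((iter f r).degree : ℝ))
    (hf' : ∀ r, ((iter f r).degree : ℝ) ≤ C' * t ^ r) : f.HasDynamicalDegree t :=
  tendsto_of_tendsto_of_tendsto_of_le_of_le (tendsto_mul_pow_rpow_inv hC ht)
    (tendsto_mul_pow_rpow_inv hC' ht) (fun r => rpow_inv_mono (by positivity) (hf r) r)
    fun r => rpow_inv_mono (Nat.cast_nonneg _) (hf' r) r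

theorem degree_conj_le (f φ ψ : PolyEnd k n) :
    (comp φ (comp f ψ)).degree ≤ (φ.degree * ψ.degree + 1) * f.degree := by
  refine (degree_comp_le _ _).trans ?_
  calc φ.degree * (comp f ψ).degree ≤ φ.degree * (f.degree * ψ.degree) :=
        Nat.mul_le_mul_left _ (degree_comp_le _ _)
    _ ≤ _ := by nlinarith

/-- Conjugation changes the degree of the iterates by a factor bounded in both directions,
independently of `r`, and the `r`-th root removes it. -/
theorem HasDynamicalDegree.conj {f φ ψ : PolyEnd k n} {l : ℝ} (h : f.HasDynamicalDegree l)
    (h1 : comp ψ φ = one k n) (h2 : comp φ ψ = one k n) :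
    (comp φ (comp f ψ)).HasDynamicalDegree l := by
  set C : ℝ := ((φ.degree * ψ.degree + 1 : ℕ) : ℝ) with hC
  have hC0 : 0 < C := by rw [hC]; positivity
  refine tendsto_of_tendsto_of_tendsto_of_le_of_le
    (tendsto_mul_rpow_inv (inv_pos.2 hC0) (fun _ => Nat.cast_nonneg _) h)
    (tendsto_mul_rpow_inv hC0 (fun _ => Nat.cast_nonneg _) h) (fun r => ?_) fun r => ?_
  · refine rpow_inv_mono (by positivity) ?_ r
    rw [inv_mul_le_iff₀ hC0, comp_conj_iter h1 h2, hC]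
    have e : iter f r = comp ψ (comp (comp φ (comp (iter f r) ψ)) φ) := by
      simp only [comp_assoc, h1, comp_one]
      rw [← comp_assoc, h1, one_comp]
    have := degree_conj_le (comp φ (comp (iter f r) ψ)) ψ φ
    rw [← e, mul_comm ψ.degree] at this
    exact_mod_cast this
  · refine rpow_inv_mono (by positivity) ?_ r
    rw [comp_conj_iter h1 h2, hC]
    exact_mod_cast degree_conj_le _ _ _

theorem iter_mem_weightSub_Iic {f : PolyEnd k n} {w : Fin n → ℝ} {t : ℝ} (ht : 0 ≤ t)
    (hf : ∀ i, f i ∈ weightSub k w (Set.Iic (t * w i))) (r : ℕ) (i : Fin n) :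
    iter f r i ∈ weightSub k w (Set.Iic (t ^ r * w i)) := by
  induction r generalizing i with
  | zero => exact X_mem_weightSub (by simp)
  | succ r ih =>
    rw [pow_succ, mul_assoc]
    exact bind₁_mem_Iic (pow_nonneg ht r) ih (hf i)

theorem exists_degree_iter_le {f : PolyEnd k n} {w : Fin n → ℝ} {t : ℝ} (ht : 0 ≤ t)
    (hw : ∀ i, 0 < w i) (hf : ∀ i, f i ∈ weightSub k w (Set.Iic (t * w i))) :
    ∃ C : ℝ, 0 < C ∧ ∀ r, ((iter f r).degree : ℝ) ≤ C * t ^ r := by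
  obtain ⟨δ, hδ, hδw⟩ : ∃ δ : ℝ, 0 < δ ∧ ∀ i, δ ≤ w i := by
    rcases isEmpty_or_nonempty (Fin n) with he | he
    · exact ⟨1, one_pos, fun i => he.elim i⟩
    · obtain ⟨i, hi⟩ := Finite.exists_min w
      exact ⟨w i, hw i, hi⟩
  set B : ℝ := 1 + ∑ i, w i with hB
  have hBw (i) : w i ≤ B := by
    have := Finset.single_le_sum (fun j _ => (hw j).le) (Finset.mem_univ i)
    linarith
  have hB0 : 0 < B := by
    have := Finset.sum_nonneg fun j (_ : j ∈ Finset.univ) => (hw j).le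
    linarith
  refine ⟨B / δ, by positivity, fun r => ?_⟩
  have hR : 0 ≤ B / δ * t ^ r := by positivity
  have : (iter f r).degree ≤ ⌊B / δ * t ^ r⌋₊ := by
    refine Finset.sup_le fun i _ => Nat.le_floor ?_
    refine (totalDegree_le_of_mem_Iic hδ hδw (mul_nonneg (pow_nonneg ht r) (hw i).le)
      (iter_mem_weightSub_Iic ht hf r i)).trans ?_
    rw [div_mul_eq_mul_div, mul_comm B]
    gcongr
    exact hBw i
  exact (Nat.cast_le.2 this).trans (Nat.floor_le hR)

/-- The weights may depend on `t`, so none are needed for `t₀` itself, where they may fail to exist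
or to be positive. -/
theorem HasDynamicalDegree.le_of_weights {f : PolyEnd k n} {l t₀ : ℝ}
    (h : f.HasDynamicalDegree l) (h0 : 0 ≤ t₀)
    (H : ∀ t > t₀, ∃ w : Fin n → ℝ, (∀ i, 0 < w i) ∧
      ∀ i, f i ∈ weightSub k w (Set.Iic (t * w i))) : l ≤ t₀ := by
  refine le_of_forall_gt_imp_ge_of_dense fun t ht => ?_
  obtain ⟨w, hw, hf⟩ := H t ht
  obtain ⟨C, hC, hd⟩ := exists_degree_iter_le (h0.trans ht.le) hw hf
  exact h.le_of_degree_le hC (h0.trans ht.le) hd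

theorem iter_hasLead {f g : PolyEnd k n} {w : Fin n → ℝ} {t : ℝ} (ht : 0 < t)
    (hf : ∀ i, HasLead w (t * w i) (f i) (g i)) (r : ℕ) (i : Fin n) :
    HasLead w (t ^ r * w i) (iter f r i) (iter g r i) := by
  induction r generalizing i with
  | zero => exact ⟨X_mem_weightSub (by simp), by simp [iter]⟩
  | succ r ih =>
    rw [pow_succ, mul_assoc]
    exact bind₁_hasLead (pow_pos ht r) ih (hf i)

/-- In contrast to the upper bound, some weights may vanish here; giving weight 0 to a variable
discards its effect on the leading part. -/
theorem exists_le_degree_iter {f g : PolyEnd k n} {w : Fin n → ℝ} {t : ℝ} (ht : 0 < t)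
    (hw : ∀ i, 0 ≤ w i) (hf : ∀ i, HasLead w (t * w i) (f i) (g i)) {i : Fin n} (hi : 0 < w i)
    (hg : ∀ r, iter g r i ≠ 0) :
    ∃ C : ℝ, 0 < C ∧ ∀ r, C * t ^ r ≤ ((iter f r).degree : ℝ) := by
  set B : ℝ := ∑ i, w i with hB
  have hBw (i) : w i ≤ B := Finset.single_le_sum (fun j _ => hw j) (Finset.mem_univ i)
  have hB0 : 0 < B := hi.trans_le (hBw i)
  refine ⟨w i / B, by positivity, fun r => ?_⟩
  have h1 := (iter_hasLead ht hf r i).le_mul_totalDegree hB0.le hBw (hg r)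
  have h2 : ((iter f r i).totalDegree : ℝ) ≤ (iter f r).degree :=
    Nat.cast_le.2 (totalDegree_le_degree _ i)
  rw [div_mul_eq_mul_div, div_le_iff₀ hB0]
  nlinarith

theorem HasDynamicalDegree.le_of_lead {f g : PolyEnd k n} {l : ℝ} (h : f.HasDynamicalDegree l)
    {w : Fin n → ℝ} {t : ℝ} (ht : 0 < t) (hw : ∀ i, 0 ≤ w i)
    (hf : ∀ i, HasLead w (t * w i) (f i) (g i)) {i : Fin n} (hi : 0 < w i)
    (hg : ∀ r, iter g r i ≠ 0) : t ≤ l := by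
  obtain ⟨C, hC, hd⟩ := exists_le_degree_iter ht hw hf hi hg
  exact h.le_of_le_degree hC ht.le hd

end PolyEnd

end AffineDyn

/-! ### Triangular automorphisms and the reduction to a permutation. -/

namespace AffineDyn

open MvPolynomial

namespace PolyEnd

variable {k : Type*} [Field k] {n : ℕ}

/-- A polynomial seen as a polynomial in the variable `s`. -/
noncomputable def toPoly (s : Fin n) :
    MvPolynomial (Fin n) k →ₐ[k] Polynomial (MvPolynomial (Fin n) k) :=
  aeval fun j => if j = s then Polynomial.X else Polynomial.C (X j)

theorem toPoly_X_self (s : Fin n) : toPoly (k := k) s (X s) = Polynomial.X := by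
  simp [toPoly]

theorem toPoly_eq_C {s : Fin n} {T : Set (Fin n)} (hs : s ∉ T) {p : MvPolynomial (Fin n) k}
    (hp : p ∈ supported k T) : toPoly s p = Polynomial.C p := by
  induction hp using Algebra.adjoin_induction with
  | mem x hx =>
    obtain ⟨j, hj, rfl⟩ := hx
    have : j ≠ s := fun h => hs (h ▸ hj)
    simp [toPoly, this]
  | algebraMap r => rw [AlgHom.commutes]; rfl
  | add x y _ _ hx hy => simp [hx, hy]
  | mul x y _ _ hx hy => simp [hx, hy]

theorem eval_toPoly (s : Fin n) (p : MvPolynomial (Fin n) k) : (toPoly s p).eval (X s) = p := by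
  induction p using MvPolynomial.induction_on with
  | C a =>
    have : toPoly s (C a : MvPolynomial (Fin n) k) = Polynomial.C (C a) := by
      simp only [← MvPolynomial.algebraMap_eq, AlgHom.commutes]
      rfl
    simp [this]
  | add p q hp hq => simp [hp, hq]
  | mul_X p i hp =>
    rw [map_mul, Polynomial.eval_mul, hp]
    by_cases h : i = s <;> simp [toPoly, h]

theorem coeff_toPoly_mem {s : Fin n} {T : Set (Fin n)} {p : MvPolynomial (Fin n) k}
    (hp : p ∈ supported k (insert s T)) (m : ℕ) : (toPoly s p).coeff m ∈ supported k T := by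
  induction hp using Algebra.adjoin_induction generalizing m with
  | mem x hx =>
    obtain ⟨j, hj, rfl⟩ := hx
    by_cases h : j = s
    · rw [h, toPoly_X_self, Polynomial.coeff_X]
      split_ifs
      exacts [one_mem _, zero_mem _]
    · simp only [toPoly, aeval_X, h, if_false, Polynomial.coeff_C]
      split_ifs
      · exact X_mem_supported.2 (hj.resolve_left h)
      · exact zero_mem _
  | algebraMap r =>
    rw [AlgHom.commutes, IsScalarTower.algebraMap_apply k (MvPolynomial (Fin n) k),
      Polynomial.algebraMap_apply, Polynomial.coeff_C]
    split_ifs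
    · exact Subalgebra.algebraMap_mem _ _
    · exact zero_mem _
  | add x y _ _ hx hy =>
    rw [map_add, Polynomial.coeff_add]
    exact add_mem (hx m) (hy m)
  | mul x y _ _ hx hy =>
    rw [map_mul, Polynomial.coeff_mul]
    exact sum_mem fun a _ => mul_mem (hx _) (hy _)

theorem bind₁_mem_supported {σ σ' : Type*} {g : σ → MvPolynomial σ' k} {S : Set σ} {T : Set σ'}
    (hg : ∀ j ∈ S, g j ∈ supported k T) {p : MvPolynomial σ k} (hp : p ∈ supported k S) :
    bind₁ g p ∈ supported k T := by
  have : supported k S ≤ (supported k T).comap (bind₁ g) := by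
    refine Algebra.adjoin_le ?_
    rintro _ ⟨j, hj, rfl⟩
    simpa using hg j hj
  exact this hp

theorem insert_Iio (i : Fin n) : insert i (Set.Iio i) = Set.Iic i := by
  ext j
  simp [le_iff_eq_or_lt]

/-- Each `fᵢ` is `aᵢ xᵢ + pᵢ` with `aᵢ ∈ k` nonzero and `pᵢ` a polynomial in the previous
variables. -/
def IsDeJonquieres (f : PolyEnd k n) : Prop :=
  ∀ i, ∃ a : k, a ≠ 0 ∧ ∃ p ∈ supported k (Set.Iio i), f i = C a * X i + p

theorem IsDeJonquieres.isTriangular {f : PolyEnd k n} (hf : IsDeJonquieres f) :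
    IsTriangular f := by
  intro i
  obtain ⟨a, -, p, hp, h⟩ := hf i
  rw [h, ← smul_eq_C_mul]
  exact add_mem (Subalgebra.smul_mem _ (X_mem_supported.2 (Set.mem_Iic.2 le_rfl)) a)
    (supported_mono Set.Iio_subset_Iic_self hp)

/-- Strong induction on `i`. As a polynomial in `xᵢ`, `τ i` has coefficients in the earlier
variables, which `g` preserves by induction; applying `g` gives `xᵢ = Q(gᵢ)`. Degrees multiply under
composition: in `xᵢ` this forces `Q` to have degree 1, and in a later variable it forces `gᵢ` to
have degree 0. The leading coefficient is then a unit, hence a constant. -/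
theorem IsTriangular.deJonquieres_step {τ g : PolyEnd k n} (hτ : IsTriangular τ)
    (h1 : comp τ g = one k n) (h2 : comp g τ = one k n) (i : Fin n) :
    g i ∈ supported k (Set.Iic i) ∧
      ∃ a : k, a ≠ 0 ∧ ∃ p ∈ supported k (Set.Iio i), τ i = C a * X i + p := by
  induction i using WellFoundedLT.induction with
  | ind i ih =>
  have hinj : Function.Injective (bind₁ g) :=
    Function.LeftInverse.injective (bind₁_bind₁_of_comp h2)
  set P := toPoly i (τ i) with hP
  set Q := P.map (bind₁ g : _ →ₐ[k] _).toRingHom with hQ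
  have hPc (m) : P.coeff m ∈ supported k (Set.Iio i) :=
    coeff_toPoly_mem (by rw [insert_Iio]; exact hτ i) m
  have hgi : ∀ q ∈ supported k (Set.Iio i), bind₁ g q ∈ supported k (Set.Iio i) := fun q hq =>
    bind₁_mem_supported (fun j hj => supported_mono
      (Set.Iic_subset_Iio.2 (Set.mem_Iio.1 hj)) (ih j hj).1) hq
  have hcomp (s : Fin n) (hs : i ≤ s) : toPoly s (X i) = Q.comp (toPoly s (g i)) := by
    have e1 : bind₁ g (τ i) = Q.eval (g i) := by
      conv_lhs => rw [← eval_toPoly i (τ i)]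
      rw [← hP, hQ, Polynomial.eval_map, Polynomial.eval₂_eq_sum_range,
        Polynomial.eval_eq_sum_range, map_sum]
      simp
    have e2 : bind₁ g (τ i) = X i := congrFun h1 i
    rw [← e2, e1, Polynomial.comp, Polynomial.eval₂_eq_sum_range, Polynomial.eval_eq_sum_range,
      map_sum]
    refine Finset.sum_congr rfl fun m _ => ?_
    rw [map_mul, map_pow]
    congr 1
    refine toPoly_eq_C (T := Set.Iio i) (by simpa using hs) ?_
    rw [hQ, Polynomial.coeff_map]
    exact hgi _ (hPc m)
  have hi := hcomp i le_rfl
  rw [toPoly_X_self] at hi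
  have hdeg := congrArg Polynomial.natDegree hi
  rw [Polynomial.natDegree_X, Polynomial.natDegree_comp] at hdeg
  obtain ⟨hd1, hd2⟩ := mul_eq_one.1 hdeg.symm
  have hPd : P.natDegree = 1 := by
    rw [← hd1]
    exact (Polynomial.natDegree_map_eq_of_injective hinj P).symm
  refine ⟨?_, ?_⟩
  · rw [mem_supported]
    intro s hs
    by_contra hsi
    rw [Set.mem_Iic, not_le] at hsi
    have h := congrArg Polynomial.natDegree (hcomp s hsi.le)
    rw [toPoly_eq_C (T := {i}) (by simpa using hsi.ne') (X_mem_supported.2 rfl),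
      Polynomial.natDegree_C, Polynomial.natDegree_comp, hd1, one_mul] at h
    have e := eval_toPoly s (g i)
    rw [Polynomial.eq_C_of_natDegree_eq_zero h.symm, Polynomial.eval_C] at e
    have hm : g i ∈ supported k {s}ᶜ := by
      rw [← e]
      exact coeff_toPoly_mem (by simp [Set.insert_eq]) 0
    exact mem_supported.1 hm hs rfl
  · have hl := congrArg Polynomial.leadingCoeff hi
    rw [Polynomial.leadingCoeff_X, Polynomial.leadingCoeff_comp (by omega)] at hl
    have hu : IsUnit (Q.coeff 1) := by
      rw [← hd1]
      exact IsUnit.of_mul_eq_one _ hl.symm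
    rw [hQ, Polynomial.coeff_map] at hu
    have hu2 := hu.map (bind₁ τ)
    have e3 : bind₁ τ ((bind₁ g : _ →ₐ[k] _).toRingHom (P.coeff 1)) = P.coeff 1 :=
      bind₁_bind₁_of_comp h2 _
    rw [e3] at hu2
    obtain ⟨a, ha, hPa⟩ := isUnit_iff_eq_C_of_isReduced.1 hu2
    refine ⟨a, ha.ne_zero, P.coeff 0, hPc 0, ?_⟩
    conv_lhs => rw [← eval_toPoly i (τ i), ← hP, Polynomial.eval_eq_sum_range, hPd]
    rw [Finset.sum_range_succ, Finset.sum_range_one, hPa]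
    ring

theorem IsTriangular.isDeJonquieres {τ : PolyEnd k n} (hτ : IsTriangular τ) (h : IsAut τ) :
    IsDeJonquieres τ := by
  obtain ⟨g, h1, h2⟩ := h
  exact fun i => (hτ.deJonquieres_step h1 h2 i).2

theorem IsTriangular.of_inverse {τ g : PolyEnd k n} (hτ : IsTriangular τ)
    (h1 : comp τ g = one k n) (h2 : comp g τ = one k n) : IsTriangular g :=
  fun i => (hτ.deJonquieres_step h1 h2 i).1

theorem IsDeJonquieres.exists_left_inverse {τ : PolyEnd k n} (hτ : IsDeJonquieres τ) :
    ∃ g : PolyEnd k n, IsDeJonquieres g ∧ comp g τ = one k n := by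
  have key (i : Fin n) : ∃ q : MvPolynomial (Fin n) k,
      (∃ a : k, a ≠ 0 ∧ ∃ p ∈ supported k (Set.Iio i), q = C a * X i + p) ∧ bind₁ τ q = X i := by
    induction i using WellFoundedLT.induction with
    | ind i ih =>
    obtain ⟨a, ha, p, hp, h⟩ := hτ i
    have : supported k (Set.Iio i) ≤ (supported k (Set.Iio i)).map (bind₁ τ) := by
      refine Algebra.adjoin_le ?_
      rintro _ ⟨j, hj, rfl⟩
      obtain ⟨q, ⟨b, -, r, hr, hq⟩, hq2⟩ := ih j hj
      refine ⟨q, ?_, hq2⟩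
      rw [hq, ← smul_eq_C_mul]
      exact add_mem (Subalgebra.smul_mem _ (X_mem_supported.2 hj) b)
        (supported_mono (Set.Iio_subset_Iio (le_of_lt hj)) hr)
    obtain ⟨p', hp', hpp⟩ := this hp
    refine ⟨C a⁻¹ * X i + C (-a⁻¹) * p', ⟨a⁻¹, inv_ne_zero ha, _, ?_, rfl⟩, ?_⟩
    · rw [← smul_eq_C_mul]
      exact Subalgebra.smul_mem _ hp' _
    · have hpp' : bind₁ τ p' = p := hpp
      have e : (C a⁻¹ * C a : MvPolynomial (Fin n) k) = 1 := by
        rw [← C_mul, inv_mul_cancel₀ ha, C_1]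
      simp only [map_add, map_mul, bind₁_C_right, bind₁_X_right, hpp', h]
      rw [C_neg]
      linear_combination X i * e
  choose g hg hg2 using key
  exact ⟨g, hg, funext hg2⟩

theorem IsDeJonquieres.isAut {τ : PolyEnd k n} (hτ : IsDeJonquieres τ) : IsAut τ := by
  obtain ⟨g, hg, h⟩ := hτ.exists_left_inverse
  obtain ⟨g', -, h'⟩ := hg.exists_left_inverse
  have : g' = τ := by
    have := comp_assoc g' g τ
    rwa [h, h', one_comp, comp_one, eq_comm] at this
  exact ⟨g, this ▸ h', h⟩

/-- The permutation of the coordinates given by `π`. -/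
noncomputable def perm (k : Type*) [Field k] (π : Equiv.Perm (Fin n)) : PolyEnd k n :=
  fun i => X (π i)

theorem perm_comp (π : Equiv.Perm (Fin n)) (f : PolyEnd k n) :
    comp (perm k π) f = fun i => f (π i) := by
  funext i
  simp [comp, perm]

theorem perm_isAut (π : Equiv.Perm (Fin n)) : IsAut (perm k π) := by
  refine ⟨perm k π.symm, ?_, ?_⟩ <;> rw [perm_comp] <;> funext i <;> simp [perm, one]

theorem mem_supported_Iio {s : Fin n} {p : MvPolynomial (Fin n) k} (hd : p.totalDegree ≤ 1)
    (hp : p ∈ supported k (Set.Iic s)) (hc : coeff (Finsupp.single s 1) p = 0) :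
    p ∈ supported k (Set.Iio s) := by
  rw [mem_supported] at *
  intro v hv
  refine lt_of_le_of_ne (Set.mem_Iic.1 (hp hv)) ?_
  rintro rfl
  obtain ⟨d, hd', hvd⟩ := (mem_vars_iff_mem_support v).1 hv
  have h1 : d.sum (fun _ e => e) ≤ 1 := (le_totalDegree hd').trans hd
  have h2 : d v ≠ 0 := Finsupp.mem_support_iff.1 hvd
  have h3 : d = Finsupp.single v 1 := by
    have hsum : d.sum (fun _ e => e) = ∑ j, d j := Finsupp.sum_fintype _ _ (by simp)
    rw [hsum] at h1
    rw [← Finset.add_sum_erase _ _ (Finset.mem_univ v)] at h1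
    have h4 : ∑ j ∈ Finset.univ.erase v, d j = 0 := by omega
    ext j
    by_cases hj : j = v
    · subst hj
      simp only [Finsupp.single_eq_same]
      omega
    · rw [Finsupp.single_eq_of_ne hj]
      exact (Finset.sum_eq_zero_iff.1 h4) j (Finset.mem_erase.2 ⟨hj, Finset.mem_univ _⟩)
  rw [h3] at hd'
  exact (mem_support_iff.1 hd') hc

theorem coeff_eq_zero_of_mem_supported {T : Set (Fin n)} {s : Fin n} (hs : s ∉ T)
    {p : MvPolynomial (Fin n) k} (hp : p ∈ supported k T) :
    coeff (Finsupp.single s 1) p = 0 := by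
  by_contra h
  refine hs (mem_supported.1 hp ((mem_vars_iff_mem_support s).2 ⟨_, mem_support_iff.2 h, ?_⟩))
  simp

/-- The rows of an affine automorphism can be reduced, by adding to each a combination of the
previous ones, so that their last variables are pairwise distinct. -/
theorem IsAffineAut.exists_reduction {α : PolyEnd k n} (hα : IsAffineAut α) :
    ∃ (L : PolyEnd k n) (π : Equiv.Perm (Fin n)), (∀ i, L i - X i ∈ supported k (Set.Iio i)) ∧
      ∀ i, bind₁ α (L i) ∈ supported k (Set.Iic (π i)) := by
  obtain ⟨α', ha1, ha2⟩ := hα.1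
  -- For each row `i`, the least possible last variable `s i` is sought among the rows obtained by
  -- adding a degree-one combination of earlier coordinates.
  let Good : Fin n → Fin n → MvPolynomial (Fin n) k → Prop := fun i s L =>
    L - X i ∈ supported k (Set.Iio i) ∧ L.totalDegree ≤ 1 ∧ bind₁ α L ∈ supported k (Set.Iic s)
  have hex (i : Fin n) : ∃ s, (∃ L, Good i s L) ∧ ∀ s' < s, ¬ ∃ L, Good i s' L := by
    have hne : {s | ∃ L, Good i s L}.Nonempty := by
      have : NeZero n := ⟨by rintro rfl; exact i.elim0⟩
      refine ⟨Fin.ofNat n (n - 1), X i, by simp, (totalDegree_X i).le, ?_⟩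
      have : Set.Iic (Fin.ofNat n (n - 1)) = Set.univ := by
        ext j
        simp only [Set.mem_Iic, Set.mem_univ, iff_true, Fin.le_def, Fin.ofNat]
        rw [Nat.mod_eq_of_lt (by have := j.2; omega)]
        have := j.2
        omega
      rw [this, supported_univ]
      trivial
    obtain ⟨s, hs, hmin⟩ := WellFounded.has_min (wellFounded_lt (α := Fin n)) _ hne
    exact ⟨s, hs, fun s' hs' hL => hmin s' hL hs'⟩
  choose s hs hmin using hex
  choose L hL using hs
  -- By minimality `x_{s i}` really occurs: otherwise the preceding variable would do, or the image
  -- would be constant, which is impossible since `α` is invertible and `L` involves `xᵢ`.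
  have key (i : Fin n) (L) (hL : Good i (s i) L) : bind₁ α L ∉ supported k (Set.Iio (s i)) := by
    intro hmem
    rcases (Set.Iio (s i)).eq_empty_or_nonempty with he | ⟨j, hj⟩
    · rw [he, supported_empty] at hmem
      obtain ⟨c, hc⟩ := Algebra.mem_bot.1 hmem
      have e := bind₁_bind₁_of_comp ha1 L
      rw [← hc, AlgHom.commutes] at e
      have h0 := coeff_eq_zero_of_mem_supported (s := i) (by simp) hL.1
      rw [← e, coeff_sub, coeff_X, MvPolynomial.algebraMap_eq, coeff_C,
        if_neg (by simp [eq_comm])] at h0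
      simp at h0
    · have hpos : 0 < (s i : ℕ) := lt_of_le_of_lt (Nat.zero_le _) (Fin.lt_def.1 hj)
      have hlt : (s i : ℕ) - 1 < n := by have := (s i).2; omega
      refine hmin i ⟨s i - 1, hlt⟩ (by rw [Fin.lt_def]; simp only; omega)
        ⟨L, hL.1, hL.2.1, supported_mono ?_ hmem⟩
      intro v hv
      have := Fin.lt_def.1 hv
      rw [Set.mem_Iic, Fin.le_def]
      simp only
      omega
  have hPd (L : MvPolynomial (Fin n) k) (h : L.totalDegree ≤ 1) :
      (bind₁ α L).totalDegree ≤ 1 := by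
    refine (totalDegree_bind₁_le α L).trans ?_
    rw [hα.2, one_mul]
    exact h
  have hne_of_lt {i j : Fin n} (hij : i < j) : s i ≠ s j := by
    intro heq
    set c := coeff (Finsupp.single (s j) 1) (bind₁ α (L i)) with hc
    set c' := coeff (Finsupp.single (s j) 1) (bind₁ α (L j)) with hc'
    have hc0 : c ≠ 0 := by
      intro h0
      refine key i _ (hL i) (mem_supported_Iio (hPd _ (hL i).2.1) (hL i).2.2 ?_)
      rw [heq]
      exact h0
    have hLi : L i ∈ supported k (Set.Iio j) := by
      have h1 := supported_mono (Set.Iio_subset_Iio hij.le) (hL i).1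
      have := add_mem h1 (X_mem_supported (R := k).2 (Set.mem_Iio.2 hij))
      simpa using this
    -- Gaussian elimination: if rows `i < j` end in the same variable, a multiple of row `i` removes
    -- it from row `j`, against the minimality of `s j`.
    have hgood : Good j (s j) (L j - C (c' / c) * L i) := by
      refine ⟨?_, ?_, ?_⟩
      · rw [sub_right_comm, ← smul_eq_C_mul]
        exact sub_mem (hL j).1 (Subalgebra.smul_mem _ hLi _)
      · refine (totalDegree_sub _ _).trans (max_le (hL j).2.1 ?_)
        rw [← smul_eq_C_mul]
        exact (totalDegree_smul_le _ _).trans (hL i).2.1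
      · rw [map_sub, map_mul, bind₁_C_right, ← smul_eq_C_mul]
        exact sub_mem (hL j).2.2 (Subalgebra.smul_mem _ (heq ▸ (hL i).2.2) _)
    refine key j _ hgood (mem_supported_Iio (hPd _ hgood.2.1) hgood.2.2 ?_)
    rw [map_sub, map_mul, bind₁_C_right, coeff_sub, coeff_C_mul, ← hc, ← hc',
      div_mul_cancel₀ _ hc0, sub_self]
  have hinj : Function.Injective s := by
    intro i j hij
    rcases lt_trichotomy i j with h | h | h
    · exact (hne_of_lt h hij).elim
    · exact h
    · exact (hne_of_lt h hij.symm).elim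
  exact ⟨L, Equiv.ofBijective s (Finite.injective_iff_bijective.1 hinj), fun i => (hL i).1,
    fun i => (hL i).2.2⟩

/-- Up to conjugation, an affine-triangular automorphism is a triangular automorphism followed by
a permutation of the coordinates. -/
theorem IsAffineTriangular.exists_conj {f : PolyEnd k n} (hf : IsAut f)
    (h : IsAffineTriangular f) : ∃ (φ ψ τ : PolyEnd k n) (π : Equiv.Perm (Fin n)),
      comp ψ φ = one k n ∧ comp φ ψ = one k n ∧ IsDeJonquieres τ ∧
      comp φ (comp f ψ) = fun i => τ (π i) := by
  obtain ⟨α, τ₀, hα, hτ₀, rfl⟩ := h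
  obtain ⟨L, π, hL, hLπ⟩ := hα.exists_reduction
  have hLJ : IsDeJonquieres L := fun i => ⟨1, one_ne_zero, _, hL i, by simp⟩
  obtain ⟨ψ, h1, h2⟩ := hLJ.isAut
  have hψ := hLJ.isTriangular.of_inverse h1 h2
  have hψa : IsAut ψ := ⟨L, h2, h1⟩
  have hFa := hLJ.isAut.comp (hf.comp hψa)
  have e : comp L (comp (comp α τ₀) ψ) = comp (comp L α) (comp τ₀ ψ) := by
    simp only [comp_assoc]
  -- `L ∘ α` is triangular once its rows are permuted by `π.symm`, and `τ₀ ∘ L⁻¹` is triangular, so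
  -- undoing the permutation in the conjugate by `L` leaves a triangular automorphism.
  refine ⟨L, ψ, comp (perm k π.symm) (comp L (comp (comp α τ₀) ψ)), π, h2, h1, ?_, ?_⟩
  · refine IsTriangular.isDeJonquieres (fun j => ?_) ((perm_isAut _).comp hFa)
    rw [perm_comp, e]
    have hj := hLπ (π.symm j)
    rw [π.apply_symm_apply] at hj
    refine bind₁_mem_supported (fun v hv => ?_) hj
    exact bind₁_mem_supported (fun u hu => supported_mono
      (Set.Iic_subset_Iic.2 (le_trans (Set.mem_Iic.1 hu) (Set.mem_Iic.1 hv))) (hψ u)) (hτ₀ v)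
  · rw [perm_comp]
    funext i
    simp

end PolyEnd

end AffineDyn

/-! ### Dominant leading parts and lower bounds for the dynamical degree. -/

namespace AffineDyn

open MvPolynomial

namespace PolyEnd

variable {k : Type*} [Field k] {n : ℕ}

theorem bind₁_comp (f g : PolyEnd k n) (p : MvPolynomial (Fin n) k) :
    bind₁ (comp f g) p = bind₁ g (bind₁ f p) :=
  (bind₁_bind₁ _ _ _).symm

/-- `f` is dominant: its components are algebraically independent. -/
def IsDominant (f : PolyEnd k n) : Prop :=
  Function.Injective (bind₁ f)

theorem IsAut.isDominant {f : PolyEnd k n} (hf : IsAut f) : IsDominant f := by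
  obtain ⟨g, h, -⟩ := hf
  exact Function.LeftInverse.injective (bind₁_bind₁_of_comp h)

theorem IsDominant.comp {f g : PolyEnd k n} (hf : IsDominant f) (hg : IsDominant g) :
    IsDominant (PolyEnd.comp f g) := by
  intro p q h
  rw [bind₁_comp, bind₁_comp] at h
  exact hf (hg h)

theorem IsDominant.iter {f : PolyEnd k n} (hf : IsDominant f) (r : ℕ) :
    IsDominant (iter f r) := by
  induction r with
  | zero => exact IsAut.isDominant ⟨one k n, one_comp _, one_comp _⟩
  | succ r ih => exact hf.comp ih

theorem bind₁_congr_of_mem_supported {S : Set (Fin n)} {g g' : PolyEnd k n}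
    (h : ∀ i ∈ S, g i = g' i) {p : MvPolynomial (Fin n) k} (hp : p ∈ supported k S) :
    bind₁ g p = bind₁ g' p := by
  induction hp using Algebra.adjoin_induction with
  | mem x hx =>
    obtain ⟨j, hj, rfl⟩ := hx
    simpa using h j hj
  | algebraMap r => simp only [AlgHom.commutes]
  | add x y _ _ hx hy => simp [hx, hy]
  | mul x y _ _ hx hy => simp [hx, hy]

theorem bind₁_eq_self {S : Set (Fin n)} {g : PolyEnd k n} (h : ∀ i ∈ S, g i = X i)
    {p : MvPolynomial (Fin n) k} (hp : p ∈ supported k S) : bind₁ g p = p := by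
  rw [bind₁_congr_of_mem_supported (g' := one k n) h hp]
  exact congrArg (fun φ : MvPolynomial (Fin n) k →ₐ[k] _ => φ p) bind₁_X_left

theorem mem_supported_iff_coeff {σ : Type*} {S : Set σ} {p : MvPolynomial σ k} :
    p ∈ supported k S ↔ ∀ d, coeff d p ≠ 0 → ∀ v, d v ≠ 0 → v ∈ S := by
  rw [mem_supported]
  constructor
  · intro h d hd v hv
    exact h ((mem_vars_iff_mem_support v).2
      ⟨d, mem_support_iff.2 hd, Finsupp.mem_support_iff.2 hv⟩)
  · intro h v hv
    obtain ⟨d, hd, hvd⟩ := (mem_vars_iff_mem_support v).1 hv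
    exact h d (mem_support_iff.1 hd) v (Finsupp.mem_support_iff.1 hvd)

/-- Replacing the variable `s` by a polynomial that involves it. -/
theorem isDominant_update {s : Fin n} {p : MvPolynomial (Fin n) k}
    (hp : ∃ d, coeff d p ≠ 0 ∧ d s ≠ 0) : IsDominant (Function.update (one k n) s p) := by
  have hdeg : (toPoly s p).natDegree ≠ 0 := by
    intro h0
    have e := eval_toPoly s p
    rw [Polynomial.eq_C_of_natDegree_eq_zero h0, Polynomial.eval_C] at e
    have hm : p ∈ supported k {s}ᶜ := by
      rw [← e]
      exact coeff_toPoly_mem (by simp [Set.insert_eq]) 0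
    obtain ⟨d, hd, hds⟩ := hp
    exact mem_supported_iff_coeff.1 hm d hd s hds rfl
  -- In the variable `s` the substitution is composition of univariate polynomials over a domain,
  -- injective because `p` is not constant in `s`.
  have key (q : MvPolynomial (Fin n) k) :
      toPoly s (bind₁ (Function.update (one k n) s p) q) = (toPoly s q).comp (toPoly s p) := by
    induction q using MvPolynomial.induction_on with
    | C a =>
      have : toPoly s (C a : MvPolynomial (Fin n) k) = Polynomial.C (C a) :=
        toPoly_eq_C (T := ∅) (by simp) (Subalgebra.algebraMap_mem _ a)
      simp [this]
    | add q q' hq hq' => simp [hq, hq']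
    | mul_X q i hq =>
      rw [map_mul, map_mul, map_mul, hq, Polynomial.mul_comp, bind₁_X_right]
      congr 1
      by_cases h : i = s
      · subst h
        simp [toPoly_X_self]
      · rw [Function.update_of_ne h, one, toPoly_eq_C (T := {i}) (by simpa using Ne.symm h)
          (X_mem_supported.2 rfl)]
        simp
  rw [IsDominant, injective_iff_map_eq_zero]
  intro q hq
  have h := key q
  rw [hq, map_zero, eq_comm, Polynomial.comp_eq_zero_iff] at h
  rcases h with h | ⟨-, h⟩
  · rw [← eval_toPoly s q, h, Polynomial.eval_zero]
  · rw [h] at hdeg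
    simp at hdeg

theorem exists_isDominant_pair {s t : Fin n} (hst : s ≠ t) {p q : MvPolynomial (Fin n) k}
    (hp : p ∈ supported k {s}) (hps : ∃ d, coeff d p ≠ 0 ∧ d s ≠ 0)
    (hqt : ∃ d, coeff d q ≠ 0 ∧ d t ≠ 0) :
    ∃ G : PolyEnd k n, IsDominant G ∧ G s = p ∧ G t = q := by
  refine ⟨_, (isDominant_update hps).comp (isDominant_update hqt), ?_, ?_⟩
  · simp only [comp, Function.update_self]
    refine bind₁_eq_self (fun i hi => ?_) hp
    rw [Set.mem_singleton_iff.1 hi, Function.update_of_ne hst, one]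
  · simp [comp, Function.update_of_ne hst.symm, one]

/-- Only the variables in `S` matter: there `g` agrees with a dominant `G` and does not leave `S`,
so its iterates on `S` are those of `G`. -/
theorem iter_ne_zero {g G : PolyEnd k n} (hG : IsDominant G) {S : Set (Fin n)}
    (hg : ∀ i ∈ S, g i = G i) (hS : ∀ i ∈ S, g i ∈ supported k S) {s : Fin n} (hs : s ∈ S) (r : ℕ) :
    iter g r s ≠ 0 := by
  have : ∀ i ∈ S, iter g r i = iter G r i := by
    induction r with
    | zero => exact fun _ _ => rfl
    | succ r ih =>
      intro i hi
      have h1 : bind₁ (iter g r) (g i) = bind₁ (iter G r) (g i) :=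
        bind₁_congr_of_mem_supported ih (hS i hi)
      rw [iter, iter, comp, comp, h1, hg i hi]
  rw [this s hs]
  have h := (hG.iter r).ne (a₁ := X s) (a₂ := 0) (X_ne_zero s)
  simpa using h

theorem hasLead_component {σ : Type*} {w : σ → ℝ} {D : ℝ} {p : MvPolynomial σ k}
    (hp : p ∈ weightSub k w (Set.Iic D)) : HasLead w D p (weightedHomogeneousComponent w D p) := by
  classical
  refine ⟨mem_weightSub.2 fun d hd => ?_, mem_weightSub.2 fun d hd => ?_⟩
  · rw [coeff_weightedHomogeneousComponent] at hd
    exact (ite_ne_right_iff.1 hd).1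
  · rw [coeff_sub, coeff_weightedHomogeneousComponent] at hd
    split_ifs at hd with h
    · simp at hd
    · rw [sub_zero] at hd
      exact lt_of_le_of_ne (mem_weightSub.1 hp d hd) h

/-- `d` is a monomial of `fᵢ` of the maximal weight `t * wᵢ`. -/
def IsTop (f : PolyEnd k n) (w : Fin n → ℝ) (t : ℝ) (i : Fin n) (d : Fin n →₀ ℕ) : Prop :=
  coeff d (f i) ≠ 0 ∧ Finsupp.weight w d = t * w i

theorem coeff_component_ne_zero {f : PolyEnd k n} {w : Fin n → ℝ} {t : ℝ} {i : Fin n}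
    {d : Fin n →₀ ℕ} :
    coeff d (weightedHomogeneousComponent w (t * w i) (f i)) ≠ 0 ↔ IsTop f w t i d := by
  classical
  rw [coeff_weightedHomogeneousComponent, ite_ne_right_iff, IsTop, and_comm]

theorem component_mem_supported {f : PolyEnd k n} {w : Fin n → ℝ} {t : ℝ} {i : Fin n}
    {S : Set (Fin n)} (h : ∀ d, IsTop f w t i d → ∀ v, d v ≠ 0 → v ∈ S) :
    weightedHomogeneousComponent w (t * w i) (f i) ∈ supported k S :=
  mem_supported_iff_coeff.2 fun d hd => h d (coeff_component_ne_zero.1 hd)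

theorem exists_coeff_component {f : PolyEnd k n} {w : Fin n → ℝ} {t : ℝ} {i v : Fin n}
    (h : ∃ d, IsTop f w t i d ∧ d v ≠ 0) :
    ∃ d, coeff d (weightedHomogeneousComponent w (t * w i) (f i)) ≠ 0 ∧ d v ≠ 0 := by
  obtain ⟨d, hd, hv⟩ := h
  exact ⟨d, coeff_component_ne_zero.2 hd, hv⟩

section Lower

variable {f : PolyEnd k n} {l : ℝ} {w : Fin n → ℝ} {t : ℝ}

theorem HasDynamicalDegree.le_of_dominant (h : f.HasDynamicalDegree l) (ht : 0 < t)
    (hw : ∀ i, 0 ≤ w i) (hf : ∀ i, f i ∈ weightSub k w (Set.Iic (t * w i))) {G : PolyEnd k n}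
    (hG : IsDominant G) {S : Set (Fin n)}
    (hg : ∀ i ∈ S, weightedHomogeneousComponent w (t * w i) (f i) = G i)
    (hS : ∀ i ∈ S, ∀ d, IsTop f w t i d → ∀ v, d v ≠ 0 → v ∈ S) {s : Fin n} (hs : s ∈ S)
    (hws : 0 < w s) : t ≤ l :=
  h.le_of_lead ht hw (fun i => hasLead_component (hf i)) hws fun r =>
    iter_ne_zero (g := fun i => weightedHomogeneousComponent w (t * w i) (f i)) hG hg
      (fun i hi => component_mem_supported (hS i hi)) hs r

theorem HasDynamicalDegree.le_of_single (h : f.HasDynamicalDegree l) (ht : 0 < t)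
    (hw : ∀ i, 0 ≤ w i) (hf : ∀ i, f i ∈ weightSub k w (Set.Iic (t * w i))) {s : Fin n}
    (hs : ∀ d, IsTop f w t s d → ∀ v, d v ≠ 0 → v = s) (hs' : ∃ d, IsTop f w t s d ∧ d s ≠ 0)
    (hws : 0 < w s) : t ≤ l := by
  refine h.le_of_dominant (S := {s}) ht hw hf (isDominant_update (exists_coeff_component hs'))
    ?_ ?_ rfl hws
  · rintro i rfl
    simp
  · rintro i rfl
    exact hs

/-- On the two variables the leading part has the form `(p(s), q(s, u))`, with `p` involving `s` and
`q` involving `u`; it is therefore dominant. -/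
theorem HasDynamicalDegree.le_of_skew (h : f.HasDynamicalDegree l) (ht : 0 < t)
    (hw : ∀ i, 0 ≤ w i) (hf : ∀ i, f i ∈ weightSub k w (Set.Iic (t * w i))) {s u : Fin n}
    (hsu : s ≠ u) (hs : ∀ d, IsTop f w t s d → ∀ v, d v ≠ 0 → v = s)
    (hs' : ∃ d, IsTop f w t s d ∧ d s ≠ 0)
    (hu : ∀ d, IsTop f w t u d → ∀ v, d v ≠ 0 → v = s ∨ v = u)
    (hu' : ∃ d, IsTop f w t u d ∧ d u ≠ 0) (hwu : 0 < w u) : t ≤ l := by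
  obtain ⟨G, hG, hGs, hGu⟩ := exists_isDominant_pair hsu (component_mem_supported hs)
    (exists_coeff_component hs') (exists_coeff_component hu')
  refine h.le_of_dominant (S := {s, u}) ht hw hf hG ?_ ?_ (s := u) (by simp) hwu
  · rintro i (rfl | rfl)
    exacts [hGs.symm, hGu.symm]
  · rintro i (rfl | rfl)
    exacts [fun d hd v hv => Or.inl (hs d hd v hv), hu]

/-- Here the leading part is `(q(s, u), p(s))`, a skew map followed by the exchange of the two
coordinates. -/
theorem HasDynamicalDegree.le_of_twisted (h : f.HasDynamicalDegree l) (ht : 0 < t)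
    (hw : ∀ i, 0 ≤ w i) (hf : ∀ i, f i ∈ weightSub k w (Set.Iic (t * w i))) {s u : Fin n}
    (hsu : s ≠ u) (hu : ∀ d, IsTop f w t u d → ∀ v, d v ≠ 0 → v = s)
    (hu' : ∃ d, IsTop f w t u d ∧ d s ≠ 0)
    (hs : ∀ d, IsTop f w t s d → ∀ v, d v ≠ 0 → v = s ∨ v = u)
    (hs' : ∃ d, IsTop f w t s d ∧ d u ≠ 0) (hws : 0 < w s) : t ≤ l := by
  obtain ⟨G, hG, hGs, hGu⟩ := exists_isDominant_pair hsu (component_mem_supported hu)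
    (exists_coeff_component hu') (exists_coeff_component hs')
  refine h.le_of_dominant (S := {s, u}) ht hw hf
    ((perm_isAut (Equiv.swap s u)).isDominant.comp hG) ?_ ?_ (s := s) (by simp) hws
  · rintro i (rfl | rfl)
    · simp [perm_comp, hGu]
    · simp [perm_comp, hGs]
  · rintro i (rfl | rfl)
    exacts [hs, fun d hd v hv => Or.inl (hu d hd v hv)]

end Lower

theorem exists_max_exponent {p : MvPolynomial (Fin n) k} (hp : p ≠ 0) (s : Fin n) :
    ∃ D, (∀ d, coeff d p ≠ 0 → d s ≤ D) ∧ ∃ d, coeff d p ≠ 0 ∧ d s = D := by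
  obtain ⟨d, hd, hmax⟩ := Finset.exists_max_image p.support (fun d => d s) (by simpa using hp)
  exact ⟨d s, fun d' hd' => hmax d' (mem_support_iff.2 hd'), d, mem_support_iff.1 hd, rfl⟩

theorem exponent_le_degree (f : PolyEnd k n) {i : Fin n} {d : Fin n →₀ ℕ}
    (hd : coeff d (f i) ≠ 0) (v : Fin n) : d v ≤ f.degree := by
  refine le_trans ?_ ((le_totalDegree (mem_support_iff.2 hd)).trans (totalDegree_le_degree f i))
  rw [Finsupp.sum_fintype _ _ (by simp)]
  exact Finset.single_le_sum (fun _ _ => Nat.zero_le _) (Finset.mem_univ v)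

theorem IsDeJonquieres.coeff_cases {τ : PolyEnd k n} (hτ : IsDeJonquieres τ) {i : Fin n}
    {d : Fin n →₀ ℕ} (hd : coeff d (τ i) ≠ 0) :
    d = Finsupp.single i 1 ∨ ∀ v, i ≤ v → d v = 0 := by
  classical
  obtain ⟨a, -, p, hp, h⟩ := hτ i
  rw [h, coeff_add, coeff_C_mul, coeff_X] at hd
  by_cases hi : Finsupp.single i 1 = d
  · exact Or.inl hi.symm
  · right
    rw [if_neg hi, mul_zero, zero_add] at hd
    intro v hv
    by_contra h0
    exact absurd (mem_supported_iff_coeff.1 hp d hd v h0) (by simpa using hv)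

theorem IsDeJonquieres.coeff_single {τ : PolyEnd k n} (hτ : IsDeJonquieres τ) (i : Fin n) :
    coeff (Finsupp.single i 1) (τ i) ≠ 0 := by
  classical
  obtain ⟨a, ha, p, hp, h⟩ := hτ i
  rw [h, coeff_add, coeff_C_mul, coeff_X, if_pos rfl,
    coeff_eq_zero_of_mem_supported (s := i) (by simp) hp]
  simpa using ha

theorem IsDeJonquieres.ne_zero {τ : PolyEnd k n} (hτ : IsDeJonquieres τ) (i : Fin n) :
    τ i ≠ 0 := by
  intro h
  have := hτ.coeff_single i
  simp [h] at this

theorem sum_pow_lt (N : ℕ) (d : Fin n → ℕ) (hd : ∀ v, d v ≤ N) (i : Fin n)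
    (hi : ∀ v, i ≤ v → d v = 0) : ∑ v, d v * (N + 1) ^ (v : ℕ) ≤ (N + 1) ^ (i : ℕ) := by
  calc ∑ v, d v * (N + 1) ^ (v : ℕ)
      ≤ ∑ v : Fin n, if (v : ℕ) < i then N * (N + 1) ^ (v : ℕ) else 0 := by
        refine Finset.sum_le_sum fun v _ => ?_
        split_ifs with h
        · exact Nat.mul_le_mul_right _ (hd v)
        · rw [hi v (Fin.le_def.2 (not_lt.1 h)), zero_mul]
    _ = ∑ m ∈ Finset.range n, if m < i then N * (N + 1) ^ m else 0 :=
        Fin.sum_univ_eq_sum_range (fun m => if m < i then N * (N + 1) ^ m else 0) n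
    _ = ∑ m ∈ Finset.range i, N * (N + 1) ^ m := by
        rw [← Finset.sum_filter]
        refine Finset.sum_congr ?_ fun _ _ => rfl
        ext m
        have := i.2
        simp only [Finset.mem_filter, Finset.mem_range]
        omega
    _ ≤ (N + 1) ^ (i : ℕ) := by
        induction (i : ℕ) with
        | zero => simp
        | succ m ih =>
          rw [Finset.sum_range_succ, pow_succ]
          nlinarith

/-- Weights growing like powers of `degree + 1` make `xᵢ` at least as heavy as any monomial of `τ i`
in the earlier variables, as for digits in base `degree + 1`. -/
theorem IsDeJonquieres.dynamicalDegree_le_one {τ : PolyEnd k n} (hτ : IsDeJonquieres τ) {l : ℝ}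
    (h : τ.HasDynamicalDegree l) : l ≤ 1 := by
  refine h.le_of_weights zero_le_one fun t ht => ⟨fun i => ((τ.degree : ℝ) + 1) ^ (i : ℕ),
    fun i => by positivity, fun i => mem_weightSub.2 fun d hd => ?_⟩
  have hle : Finsupp.weight (fun i : Fin n => ((τ.degree : ℝ) + 1) ^ (i : ℕ)) d ≤
      ((τ.degree : ℝ) + 1) ^ (i : ℕ) := by
    rw [Finsupp.weight_eq_sum]
    rcases hτ.coeff_cases hd with rfl | h0
    · rw [Finset.sum_eq_single i] <;> simp +contextual [Finsupp.single_eq_of_ne]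
    · have := sum_pow_lt τ.degree d (exponent_le_degree τ hd) i h0
      simp only [nsmul_eq_mul]
      exact_mod_cast this
  refine hle.trans ?_
  have : (0 : ℝ) < ((τ.degree : ℝ) + 1) ^ (i : ℕ) := by positivity
  nlinarith

end PolyEnd

end AffineDyn

/-! ### Two families of automorphisms of three-space. -/

namespace AffineDyn

open MvPolynomial

namespace PolyEnd

variable {k : Type*} [Field k]

/-- The weights `a`, `b`, `c` on the variables `s`, `u` and the third one. -/
def triple (s u : Fin 3) (a b c : ℝ) : Fin 3 → ℝ :=
  fun i => if i = s then a else if i = u then b else c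

section Triple

variable {s u v : Fin 3} (a b c : ℝ)

theorem triple_fst : triple s u a b c s = a := by simp [triple]

theorem triple_snd (hsu : s ≠ u) : triple s u a b c u = b := by simp [triple, hsu.symm]

theorem triple_thd (hsv : s ≠ v) (huv : u ≠ v) : triple s u a b c v = c := by
  simp [triple, hsv.symm, huv.symm]

theorem eq_or_of_distinct (hsu : s ≠ u) (hsv : s ≠ v) (huv : u ≠ v) (i : Fin 3) :
    i = s ∨ i = u ∨ i = v := by
  revert s u v i
  decide

theorem weight_triple (hsu : s ≠ u) (hsv : s ≠ v) (huv : u ≠ v) (d : Fin 3 →₀ ℕ) :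
    Finsupp.weight (triple s u a b c) d = d s * a + d u * b + d v * c := by
  have huniv : (Finset.univ : Finset (Fin 3)) = {s, u, v} := by
    ext i
    simpa using eq_or_of_distinct hsu hsv huv i
  rw [Finsupp.weight_eq_sum, huniv, Finset.sum_insert (by simp [hsu, hsv]),
    Finset.sum_insert (by simp [huv]), Finset.sum_singleton, triple_fst, triple_snd _ _ _ hsu,
    triple_thd _ _ _ hsv huv]
  simp only [nsmul_eq_mul]
  ring

theorem mem_weightSub_triple (hsu : s ≠ u) (hsv : s ≠ v) (huv : u ≠ v) {f : PolyEnd k 3} {t : ℝ}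
    (h0 : ∀ d, coeff d (f s) ≠ 0 → d s * a + d u * b + d v * c ≤ t * a)
    (h1 : ∀ d, coeff d (f u) ≠ 0 → d s * a + d u * b + d v * c ≤ t * b)
    (h2 : ∀ d, coeff d (f v) ≠ 0 → d s * a + d u * b + d v * c ≤ t * c) (i : Fin 3) :
    f i ∈ weightSub k (triple s u a b c) (Set.Iic (t * triple s u a b c i)) := by
  refine mem_weightSub.2 fun d hd => ?_
  rw [Set.mem_Iic, weight_triple _ _ _ hsu hsv huv]
  rcases eq_or_of_distinct hsu hsv huv i with rfl | rfl | rfl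
  · rw [triple_fst]
    exact h0 d hd
  · rw [triple_snd _ _ _ hsu]
    exact h1 d hd
  · rw [triple_thd _ _ _ hsv huv]
    exact h2 d hd

variable {a b c}

theorem triple_pos (ha : 0 < a) (hb : 0 < b) (hc : 0 < c) (i : Fin 3) :
    0 < triple s u a b c i := by
  unfold triple
  split_ifs <;> assumption

theorem triple_nonneg (ha : 0 ≤ a) (hb : 0 ≤ b) (hc : 0 ≤ c) (i : Fin 3) :
    0 ≤ triple s u a b c i := by
  unfold triple
  split_ifs <;> assumption

end Triple

/-- Automorphisms over an affine automorphism of a line, of Hénon type on the fibres. -/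
theorem HasDynamicalDegree.eq_natCast_of_fibred {f : PolyEnd k 3} {l : ℝ}
    (h : f.HasDynamicalDegree l) (hl : 1 < l) {s u v : Fin 3} (hsu : s ≠ u) (hsv : s ≠ v)
    (huv : u ≠ v)
    (h0 : ∀ d, coeff d (f s) ≠ 0 → d s ≤ 1 ∧ d u = 0 ∧ d v = 0)
    (h0' : ∃ d, coeff d (f s) ≠ 0 ∧ d s ≠ 0)
    (h1 : ∀ d, coeff d (f u) ≠ 0 → (d s = 0 ∧ d u = 0 ∧ d v = 1) ∨ d v = 0) (h1' : f u ≠ 0)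
    (h2 : ∀ d, coeff d (f v) ≠ 0 → (d s = 0 ∧ d u = 1 ∧ d v = 0) ∨ (d u = 0 ∧ d v = 0)) :
    ∃ D : ℕ, l = D := by
  obtain ⟨D, hD, d₀, hd₀, hd₀D⟩ := exists_max_exponent h1' u
  have upper : l ≤ max (D : ℝ) 1 := by
    refine h.le_of_weights (by positivity) fun t ht => ?_
    have ht1 : 1 < t := lt_of_le_of_lt (le_max_right _ _) ht
    have htD : (D : ℝ) < t := lt_of_le_of_lt (le_max_left _ _) ht
    set N : ℝ := (f.degree : ℝ) with hN
    have hN0 : 0 ≤ N := Nat.cast_nonneg _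
    -- With weights `1`, `t * M`, `M` on `s`, `u`, `v`, a monomial of `f u` without `v` needs `N + D
    -- * t * M ≤ t ^ 2 * M`, and the powers of `s` in `f v` need `N ≤ t * M`; both hold for `M`
    -- large because `t > D`.
    obtain ⟨M, hM1, hMN, hM⟩ : ∃ M : ℝ, 0 < M ∧ N ≤ M ∧ N ≤ t * (t - D) * M := by
      have hp : 0 < t * (t - D) := mul_pos (by linarith) (by linarith)
      refine ⟨N / (t * (t - D)) + N + 1, by positivity, ?_, ?_⟩
      · have : 0 ≤ N / (t * (t - D)) := by positivity
        linarith
      · have : t * (t - D) * (N / (t * (t - D))) = N := mul_div_cancel₀ _ hp.ne'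
        nlinarith
    refine ⟨triple s u 1 (t * M) M, triple_pos one_pos (by positivity) hM1,
      mem_weightSub_triple _ _ _ hsu hsv huv ?_ ?_ ?_⟩
    · intro d hd
      obtain ⟨e0, e1, e2⟩ := h0 d hd
      have : (d s : ℝ) ≤ 1 := by exact_mod_cast e0
      rw [e1, e2]
      push_cast
      linarith
    · intro d hd
      rcases h1 d hd with ⟨e0, e1, e2⟩ | e2
      · rw [e0, e1, e2]
        push_cast
        nlinarith [mul_pos (sub_pos.2 ht1) hM1,
          mul_pos (mul_pos (sub_pos.2 ht1) hM1) (zero_lt_one.trans ht1)]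
      · rw [e2]
        have a1 : (d s : ℝ) ≤ N := Nat.cast_le.2 (exponent_le_degree f hd s)
        have a2 : (d u : ℝ) ≤ D := by exact_mod_cast hD d hd
        have a3 : 0 < t * M := by positivity
        push_cast
        nlinarith
    · intro d hd
      have a1 : (d s : ℝ) ≤ N := Nat.cast_le.2 (exponent_le_degree f hd s)
      rcases h2 d hd with ⟨e0, e1, e2⟩ | ⟨e1, e2⟩
      · rw [e0, e1, e2]
        push_cast
        linarith
      · rw [e1, e2]
        push_cast
        nlinarith
  have hD2 : 2 ≤ D := by
    by_contra hlt
    have : (D : ℝ) ≤ 1 := by exact_mod_cast (by omega : D ≤ 1)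
    rw [max_eq_right this] at upper
    linarith
  have hD2' : (2 : ℝ) ≤ D := by exact_mod_cast hD2
  rw [max_eq_left (by linarith)] at upper
  refine ⟨D, le_antisymm upper ?_⟩
  -- For the lower bound the base variable gets weight 0, so the leading part of `f u` consists of
  -- its terms of degree `D` in `u`, with coefficients in `s`.
  have e0 := triple_fst (s := s) (u := u) 0 (D : ℝ) 1
  have e1 := triple_snd 0 (D : ℝ) 1 hsu
  refine h.le_of_skew (w := triple s u 0 D 1) (by linarith)
    (triple_nonneg le_rfl (by linarith) zero_le_one)
    (mem_weightSub_triple _ _ _ hsu hsv huv ?_ ?_ ?_) hsu ?_ ?_ ?_ ?_ (by rw [e1]; linarith)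
  · intro d hd
    obtain ⟨-, e1, e2⟩ := h0 d hd
    simp [e1, e2]
  · intro d hd
    rcases h1 d hd with ⟨e0, e1, e2⟩ | e2
    · rw [e0, e1, e2]
      push_cast
      nlinarith
    · have a2 : (d u : ℝ) ≤ D := by exact_mod_cast hD d hd
      rw [e2]
      push_cast
      nlinarith
  · intro d hd
    rcases h2 d hd with ⟨e0, e1, e2⟩ | ⟨e1, e2⟩ <;> simp [e1, e2]
  · intro d hd w hw
    obtain ⟨-, e1, e2⟩ := h0 d hd.1
    rcases eq_or_of_distinct hsu hsv huv w with rfl | rfl | rfl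
    exacts [rfl, (hw e1).elim, (hw e2).elim]
  · obtain ⟨d, hd, hds⟩ := h0'
    obtain ⟨-, e1', e2⟩ := h0 d hd
    refine ⟨d, ⟨hd, ?_⟩, hds⟩
    rw [weight_triple _ _ _ hsu hsv huv, e0, e1', e2]
    simp
  · intro d hd w hw
    have hd2 := hd.2
    rw [weight_triple _ _ _ hsu hsv huv, e1] at hd2
    rcases h1 d hd.1 with ⟨e0, e1, e2⟩ | e2
    · rw [e0, e1, e2] at hd2
      push_cast at hd2
      nlinarith
    · rcases eq_or_of_distinct hsu hsv huv w with rfl | rfl | rfl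
      exacts [Or.inl rfl, Or.inr rfl, (hw e2).elim]
  · refine ⟨d₀, ⟨hd₀, ?_⟩, by omega⟩
    rw [weight_triple _ _ _ hsu hsv huv, e1]
    rcases h1 d₀ hd₀ with ⟨e0, e1, e2⟩ | e2
    · omega
    · rw [e2, hd₀D]
      simp

/-- The positive root of `t² = i t + m`. -/
noncomputable def posRoot (i m : ℝ) : ℝ := (i + √(i ^ 2 + 4 * m)) / 2

theorem posRoot_sq {i m : ℝ} (hm : 0 ≤ m) :
    posRoot i m ^ 2 = i * posRoot i m + m := by
  have := Real.sq_sqrt (show 0 ≤ i ^ 2 + 4 * m by positivity)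
  unfold posRoot
  linear_combination this / 4

/-- With `θ` the positive root, `t ^ 2 - i * t - m = (t - θ) * (t + θ - i)`, and `θ ≥ i`. -/
theorem le_sq_of_posRoot_le {i m t : ℝ} (hi : 0 ≤ i) (hm : 0 ≤ m) (h : posRoot i m ≤ t) :
    i * t + m ≤ t ^ 2 := by
  have h1 := posRoot_sq (i := i) hm
  have h2 : i ≤ posRoot i m := by
    have : i ≤ √(i ^ 2 + 4 * m) := Real.le_sqrt_of_sq_le (by linarith)
    unfold posRoot
    linarith
  nlinarith [mul_nonneg (sub_nonneg.2 h) (by linarith : 0 ≤ t + posRoot i m - i)]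

/-- Automorphisms of the form `(b z + q(x, y), β y + p(x), ℓ(x, y))` with `ℓ` affine and `p` of
degree `e`, where `ℓ` involves `y` only if `e = 1`. -/
theorem HasDynamicalDegree.exists_of_recurrence {f : PolyEnd k 3} {l : ℝ}
    (h : f.HasDynamicalDegree l) (hl : 1 < l) {e : ℕ} (he : 1 ≤ e)
    (h0 : ∀ d, coeff d (f 0) ≠ 0 → (d 0 = 0 ∧ d 1 = 0 ∧ d 2 = 1) ∨ d 2 = 0)
    (h1 : ∀ d, coeff d (f 1) ≠ 0 →
      (d 0 = 0 ∧ d 1 = 1 ∧ d 2 = 0) ∨ (d 0 ≤ e ∧ d 1 = 0 ∧ d 2 = 0))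
    (h1' : ∃ d, coeff d (f 1) ≠ 0 ∧ d 0 = e)
    (h2 : ∀ d, coeff d (f 2) ≠ 0 →
      (d 0 ≤ 1 ∧ d 1 = 0 ∧ d 2 = 0) ∨ (e = 1 ∧ d 0 = 0 ∧ d 1 ≤ 1 ∧ d 2 = 0)) :
    ∃ i j : ℕ, l ^ 2 = i * l + j := by
  have hsu : (0 : Fin 3) ≠ 1 := by decide
  have hsv : (0 : Fin 3) ≠ 2 := by decide
  have huv : (1 : Fin 3) ≠ 2 := by decide
  have he' : (1 : ℝ) ≤ e := by exact_mod_cast he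
  -- With weights `(t, e, t)` the last two components satisfy the bound for every `t > 1`. The only
  -- real condition comes from the monomials `x ^ i * y ^ j` of `q`, namely `i * t + j * e ≤ t ^ 2`.
  have mem (t : ℝ) (ht : 1 < t)
      (H : ∀ d, coeff d (f 0) ≠ 0 → d 2 = 0 → d 0 * t + d 1 * (e : ℝ) ≤ t ^ 2) (i : Fin 3) :
      f i ∈ weightSub k (triple 0 1 t e t) (Set.Iic (t * triple 0 1 t e t i)) := by
    refine mem_weightSub_triple _ _ _ hsu hsv huv ?_ ?_ ?_ i
    · intro d hd
      rcases h0 d hd with ⟨e0, e1, e2⟩ | e2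
      · rw [e0, e1, e2]
        push_cast
        nlinarith
      · have := H d hd e2
        rw [e2]
        push_cast
        linarith
    · intro d hd
      rcases h1 d hd with ⟨e0, e1, e2⟩ | ⟨e0, e1, e2⟩
      · rw [e0, e1, e2]
        push_cast
        nlinarith
      · have : (d 0 : ℝ) ≤ e := by exact_mod_cast e0
        rw [e1, e2]
        push_cast
        nlinarith
    · intro d hd
      rcases h2 d hd with ⟨e0, e1, e2⟩ | ⟨ee, e0, e1, e2⟩
      · have : (d 0 : ℝ) ≤ 1 := by exact_mod_cast e0
        rw [e1, e2]
        push_cast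
        nlinarith
      · have : (d 1 : ℝ) ≤ 1 := by exact_mod_cast e1
        rw [ee, e0, e2]
        push_cast
        nlinarith
  have upper (θ : ℝ) (hθ : 1 ≤ θ) (H : ∀ d, coeff d (f 0) ≠ 0 → d 2 = 0 →
      posRoot (d 0) (d 1 * e) ≤ θ) : l ≤ θ := by
    refine h.le_of_weights (by linarith) fun t ht => ⟨triple 0 1 t e t,
      triple_pos (by linarith) (by linarith) (by linarith), mem t (by linarith) fun d hd hd2 => ?_⟩
    exact le_sq_of_posRoot_le (Nat.cast_nonneg _) (by positivity) ((H d hd hd2).trans ht.le)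
  -- The monomial of `q` with the largest root decides; if there were none, the upper bound would
  -- give `l ≤ 1`.
  obtain ⟨d₀, ⟨hd₀, hd₀2⟩, hmax⟩ : ∃ d₀, (coeff d₀ (f 0) ≠ 0 ∧ d₀ 2 = 0) ∧
      ∀ d, coeff d (f 0) ≠ 0 → d 2 = 0 →
        posRoot (d 0) (d 1 * e) ≤ posRoot (d₀ 0) (d₀ 1 * e) := by
    have hne : ((f 0).support.filter fun d => d 2 = 0).Nonempty := by
      rw [Finset.nonempty_iff_ne_empty]
      intro hempty
      refine absurd (upper 1 le_rfl fun d hd hd2 => ?_) (not_le.2 hl)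
      have : d ∈ (f 0).support.filter fun d => d 2 = 0 := by simp [hd, hd2]
      rw [hempty] at this
      simp at this
    obtain ⟨d₀, hd₀, hmax⟩ := Finset.exists_max_image _
      (fun d : Fin 3 →₀ ℕ => posRoot (d 0) (d 1 * e)) hne
    simp only [Finset.mem_filter, mem_support_iff] at hd₀ hmax
    exact ⟨d₀, hd₀, fun d hd hd2 => hmax d ⟨hd, hd2⟩⟩
  set θ := posRoot (d₀ 0) (d₀ 1 * e) with hθdef
  have hsq : θ ^ 2 = d₀ 0 * θ + d₀ 1 * e := posRoot_sq (by positivity)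
  have hθ : 1 < θ := by
    by_contra hle
    exact absurd (upper 1 le_rfl fun d hd hd2 => (hmax d hd hd2).trans (not_lt.1 hle)) (not_le.2 hl)
  have hlθ : l ≤ θ := upper θ hθ.le hmax
  suffices hθl : θ ≤ l by
    refine ⟨d₀ 0, d₀ 1 * e, ?_⟩
    rw [le_antisymm hlθ hθl]
    push_cast
    exact hsq
  have hw0 := triple_fst (s := 0) (u := 1) θ (e : ℝ) θ
  have hw1 := triple_snd θ (e : ℝ) θ hsu
  have hmem := mem θ hθ fun d hd hd2 => le_sq_of_posRoot_le (Nat.cast_nonneg _) (by positivity)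
    (hmax d hd hd2)
  have hnn : ∀ i, 0 ≤ triple 0 1 θ (e : ℝ) θ i :=
    triple_nonneg (by linarith) (by linarith) (by linarith)
  have htop2 (d) (hd : IsTop f (triple 0 1 θ e θ) θ 0 d) : d 2 = 0 := by
    rcases h0 d hd.1 with ⟨e0, e1, e2⟩ | e2
    · have := hd.2
      rw [weight_triple _ _ _ hsu hsv huv, hw0, e0, e1, e2] at this
      push_cast at this
      nlinarith
    · exact e2
  have htop₀ : IsTop f (triple 0 1 θ e θ) θ 0 d₀ := by
    refine ⟨hd₀, ?_⟩
    rw [weight_triple _ _ _ hsu hsv huv, hw0, hd₀2]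
    push_cast
    linarith
  -- If `y` occurs in the leading part of `f 0`, the leading part is twisted, `(q'(x, y), c x ^ e)`.
  -- Otherwise it reduces to a power of `x` alone in the first component.
  by_cases hy : ∃ d, IsTop f (triple 0 1 θ e θ) θ 0 d ∧ d 1 ≠ 0
  · refine h.le_of_twisted (by linarith) hnn hmem hsu ?_ ?_ ?_ hy (by rw [hw0]; linarith)
    · intro d hd w hw
      rcases h1 d hd.1 with ⟨e0, e1, e2⟩ | ⟨e0, e1, e2⟩
      · have := hd.2
        rw [weight_triple _ _ _ hsu hsv huv, hw1, e0, e1, e2] at this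
        push_cast at this
        nlinarith
      · rcases eq_or_of_distinct hsu hsv huv w with rfl | rfl | rfl
        exacts [rfl, (hw e1).elim, (hw e2).elim]
    · obtain ⟨d, hd, hde⟩ := h1'
      refine ⟨d, ⟨hd, ?_⟩, by omega⟩
      rcases h1 d hd with ⟨e0, e1, e2⟩ | ⟨e0, e1, e2⟩
      · omega
      · rw [weight_triple _ _ _ hsu hsv huv, hw1, e1, e2, hde]
        push_cast
        ring
    · intro d hd w hw
      have e2 := htop2 d hd
      rcases eq_or_of_distinct hsu hsv huv w with rfl | rfl | rfl
      exacts [Or.inl rfl, Or.inr rfl, (hw e2).elim]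
  · push Not at hy
    refine h.le_of_single (by linarith) hnn hmem (s := 0) ?_ ⟨d₀, htop₀, ?_⟩ (by rw [hw0]; linarith)
    · intro d hd w hw
      have e1 := hy d hd
      have e2 := htop2 d hd
      rcases eq_or_of_distinct hsu hsv huv w with rfl | rfl | rfl
      exacts [rfl, (hw e1).elim, (hw e2).elim]
    · intro hz
      rw [hz, hy d₀ htop₀] at hsq
      push_cast at hsq
      nlinarith

end PolyEnd

end AffineDyn

/-! ### Hénon type, and dimensions one and two. -/

namespace AffineDyn

open MvPolynomial

namespace PolyEnd

variable {k : Type*} [Field k] {n : ℕ}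

theorem weight_eq_of_two {s u : Fin n} (hsu : s ≠ u) (w : Fin n → ℝ) {d : Fin n →₀ ℕ}
    (hd : ∀ v, v ≠ s → v ≠ u → d v = 0) : Finsupp.weight w d = d s * w s + d u * w u := by
  rw [Finsupp.weight_eq_sum, Finset.sum_eq_add s u hsu]
  · simp
  · rintro c - ⟨h1, h2⟩
    simp [hd c h1 h2]
  · simp
  · simp

/-- Automorphisms that extend an automorphism of Hénon type of a plane. -/
theorem HasDynamicalDegree.eq_natCast_of_henon {f : PolyEnd k n} {l : ℝ}
    (h : f.HasDynamicalDegree l) (hl : 1 < l) {s u : Fin n} (hsu : s ≠ u)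
    (hs : ∀ d, coeff d (f s) ≠ 0 → d = Finsupp.single u 1 ∨ ∀ v, v ≠ s → d v = 0) (hs' : f s ≠ 0)
    (hu : ∀ d, coeff d (f u) ≠ 0 → d = Finsupp.single s 1 ∨ d = 0)
    (hv : ∀ v, v ≠ s → v ≠ u → ∀ d, coeff d (f v) ≠ 0 →
      d = Finsupp.single v 1 ∨ ∀ x, x ≠ s → x ≠ u → d x = 0) :
    ∃ D : ℕ, l = D := by
  obtain ⟨D, hD, d₀, hd₀, hd₀D⟩ := exists_max_exponent hs' s
  set N : ℝ := (f.degree : ℝ) with hN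
  have hN0 : 0 ≤ N := Nat.cast_nonneg _
  have hpos {t : ℝ} (ht : 1 < t) (i : Fin n) :
      0 < (if i = s then t else if i = u then 1 else N * (t + 1) + 1 : ℝ) := by
    split_ifs <;> positivity
  -- On the plane the weights `t`, `1` reflect that `f u` is affine in `x_s`. A monomial in `x_s`,
  -- `x_u` of a further component has weight at most `N * t + N`, whence the weight `N * (t + 1) +
  -- 1` of the other variables.
  have mem (t : ℝ) (ht : 1 < t) (htD : D ≤ t) (i : Fin n) : f i ∈ weightSub k
      (fun i => if i = s then t else if i = u then 1 else N * (t + 1) + 1)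
      (Set.Iic (t * if i = s then t else if i = u then 1 else N * (t + 1) + 1)) := by
    refine mem_weightSub.2 fun d hd => ?_
    rw [Set.mem_Iic]
    by_cases his : i = s
    · subst his
      rcases hs d hd with rfl | hd0
      · simp only [Finsupp.weight_single, one_smul, hsu.symm, if_true, if_false]
        nlinarith
      · rw [weight_eq_of_two hsu _ fun v hv _ => hd0 v hv, hd0 u hsu.symm]
        have : (d i : ℝ) ≤ D := by exact_mod_cast hD d hd
        simp only [if_true]
        push_cast
        nlinarith
    by_cases hiu : i = u
    · subst hiu
      rcases hu d hd with rfl | rfl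
      · simp [Finsupp.weight_single, hsu.symm]
      · simp only [map_zero, hsu.symm, if_true, if_false]
        linarith
    · have hW : 0 ≤ N * (t + 1) := by positivity
      rcases hv i his hiu d hd with rfl | hd0
      · simp only [Finsupp.weight_single, one_smul, his, hiu, if_false]
        nlinarith
      · rw [weight_eq_of_two hsu _ hd0]
        have a1 : (d s : ℝ) ≤ N := Nat.cast_le.2 (exponent_le_degree f hd s)
        have a2 : (d u : ℝ) ≤ N := Nat.cast_le.2 (exponent_le_degree f hd u)
        simp only [his, hiu, hsu.symm, if_true, if_false]
        nlinarith
  have upper : l ≤ max (D : ℝ) 1 := h.le_of_weights (by positivity) fun t ht =>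
    ⟨_, hpos (lt_of_le_of_lt (le_max_right _ _) ht),
      mem t (lt_of_le_of_lt (le_max_right _ _) ht) ((le_max_left _ _).trans ht.le)⟩
  have hD2 : 2 ≤ D := by
    by_contra hlt
    have : (D : ℝ) ≤ 1 := by exact_mod_cast (by omega : D ≤ 1)
    rw [max_eq_right this] at upper
    linarith
  have hD2' : (2 : ℝ) ≤ D := by exact_mod_cast hD2
  rw [max_eq_left (by linarith)] at upper
  refine ⟨D, le_antisymm upper ?_⟩
  refine h.le_of_single (s := s) (by linarith) (fun i => (hpos (by linarith) i).le)
    (mem D (by linarith) le_rfl) ?_ ?_ (hpos (by linarith) s)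
  · intro d hd v hvd
    rcases hs d hd.1 with rfl | hd0
    · have := hd.2
      simp only [Finsupp.weight_single, one_smul, hsu.symm, if_true, if_false] at this
      nlinarith
    · by_contra hne
      exact hvd (hd0 v hne)
  · refine ⟨d₀, ⟨hd₀, ?_⟩, by omega⟩
    rcases hs d₀ hd₀ with rfl | hd0
    · rw [Finsupp.single_eq_of_ne hsu] at hd₀D
      omega
    · rw [weight_eq_of_two hsu _ fun v hv _ => hd0 v hv, hd0 u hsu.symm, hd₀D]
      simp

/-- The dynamical degree of an affine-triangular automorphism is that of one in normal form. -/
theorem HasDynamicalDegree.exists_normalForm {f : PolyEnd k n} {l : ℝ}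
    (h : f.HasDynamicalDegree l) (hf : IsAut f) (hf' : IsAffineTriangular f) :
    ∃ (τ : PolyEnd k n) (π : Equiv.Perm (Fin n)), IsDeJonquieres τ ∧
      HasDynamicalDegree (fun i => τ (π i)) l := by
  obtain ⟨φ, ψ, τ, π, h1, h2, hτ, hπ⟩ := hf'.exists_conj hf
  exact ⟨τ, π, hτ, hπ ▸ h.conj h1 h2⟩

theorem dynamicalDegree_le_one_of_dim_one {f : PolyEnd k 1} {l : ℝ} (h : f.HasDynamicalDegree l)
    (hf : IsAut f) (hf' : IsAffineTriangular f) : l ≤ 1 := by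
  obtain ⟨τ, π, hτ, h'⟩ := h.exists_normalForm hf hf'
  rw [Subsingleton.elim π 1] at h'
  exact hτ.dynamicalDegree_le_one h'

theorem dynamicalDegree_of_dim_two {f : PolyEnd k 2} {l : ℝ} (h : f.HasDynamicalDegree l)
    (hf : IsAut f) (hf' : IsAffineTriangular f) (hl : 1 < l) : ∃ D : ℕ, l = D := by
  obtain ⟨τ, π, hτ, h'⟩ := h.exists_normalForm hf hf'
  have hπ : ∀ π : Equiv.Perm (Fin 2), π = 1 ∨ (π 0 = 1 ∧ π 1 = 0) := by decide
  rcases hπ π with rfl | ⟨hπ0, hπ1⟩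
  · exact absurd (hτ.dynamicalDegree_le_one h') (not_le.2 hl)
  · refine h'.eq_natCast_of_henon hl (s := 0) (u := 1) (by decide) ?_ (hτ.ne_zero _) ?_ ?_
    · intro d hd
      simp only [hπ0] at hd
      refine (hτ.coeff_cases hd).imp id fun h v hv => h v ?_
      omega
    · intro d hd
      simp only [hπ1] at hd
      refine (hτ.coeff_cases hd).imp id fun h => Finsupp.ext fun v => h v (Fin.zero_le v)
    · intro v h0 h1
      omega

end PolyEnd

end AffineDyn

/-! ### Dimension three, one permutation at a time. -/

namespace AffineDyn

open MvPolynomial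

namespace PolyEnd

variable {k : Type*} [Field k] {n : ℕ}

theorem coeff_linear_add_cases {v : Fin n} {a : k} {p : MvPolynomial (Fin n) k} {T : Set (Fin n)}
    (hp : p ∈ supported k T) {d : Fin n →₀ ℕ} (hd : coeff d (C a * X v + p) ≠ 0) :
    d = Finsupp.single v 1 ∨ ∀ x, x ∉ T → d x = 0 := by
  classical
  rw [coeff_add, coeff_C_mul, coeff_X] at hd
  by_cases hi : Finsupp.single v 1 = d
  · exact Or.inl hi.symm
  · right
    rw [if_neg hi, mul_zero, zero_add] at hd
    intro x hx
    by_contra h0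
    exact hx (mem_supported_iff_coeff.1 hp d hd x h0)

/-- Both 3-cycles are conjugated to this shape. It is the case `e = 1` of `exists_of_recurrence`,
where the last component may involve `y`. -/
theorem HasDynamicalDegree.exists_of_shift {f : PolyEnd k 3} {l : ℝ}
    (h : f.HasDynamicalDegree l) (hl : 1 < l) {a b c : k} (ha : a ≠ 0)
    {q p r : MvPolynomial (Fin 3) k} (hq : q ∈ supported k {0, 1}) (hp : p ∈ supported k ∅)
    (hr : r ∈ supported k ∅) (h0 : f 0 = C b * X 2 + q) (h1 : f 1 = C a * X 0 + p)
    (h2 : f 2 = C c * X 1 + r) : ∃ i j : ℕ, l ^ 2 = i * l + j := by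
  refine h.exists_of_recurrence hl (e := 1) le_rfl ?_ ?_ ⟨Finsupp.single 0 1, ?_, by simp⟩ ?_
  · intro d hd
    rw [h0] at hd
    rcases coeff_linear_add_cases hq hd with rfl | hd
    · simp
    · exact Or.inr (hd 2 (by simp))
  · intro d hd
    rw [h1] at hd
    rcases coeff_linear_add_cases hp hd with rfl | hd
    · simp
    · simp [hd]
  · rw [h1, coeff_add, coeff_C_mul, coeff_X, if_pos rfl,
      coeff_eq_zero_of_mem_supported (s := 0) (by simp) hp]
    simpa using ha
  · intro d hd
    rw [h2] at hd
    rcases coeff_linear_add_cases hr hd with rfl | hd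
    · simp
    · simp [hd]

theorem C_mul_mem_supported {S : Set (Fin n)} (a : k) {p : MvPolynomial (Fin n) k}
    (hp : p ∈ supported k S) : C a * p ∈ supported k S := by
  rw [← smul_eq_C_mul]
  exact Subalgebra.smul_mem _ hp a

theorem Iio_zero_fin_three : Set.Iio (0 : Fin 3) = ∅ := by ext i; simp

theorem Iio_one_fin_three : Set.Iio (1 : Fin 3) = {0} := by ext i; fin_cases i <;> simp

theorem Iio_two_fin_three : Set.Iio (2 : Fin 3) = {0, 1} := by ext i; fin_cases i <;> simp

/-- The cyclic permutation `(τ₃, τ₁, τ₂)`. -/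
theorem HasDynamicalDegree.exists_of_cycle {τ f : PolyEnd k 3} (hτ : IsDeJonquieres τ) {l : ℝ}
    (h : f.HasDynamicalDegree l) (hl : 1 < l) (h0 : f 0 = τ 2) (h1 : f 1 = τ 0)
    (h2 : f 2 = τ 1) : ∃ i j : ℕ, l ^ 2 = i * l + j := by
  obtain ⟨a₀, ha₀, p₀, hp₀, e₀⟩ := hτ 0
  obtain ⟨a₁, ha₁, p₁, hp₁, e₁⟩ := hτ 1
  obtain ⟨a₂, ha₂, p₂, hp₂, e₂⟩ := hτ 2
  rw [Iio_zero_fin_three] at hp₀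
  rw [Iio_one_fin_three] at hp₁
  rw [Iio_two_fin_three] at hp₂
  have fix₀ (g : PolyEnd k 3) : bind₁ g p₀ = p₀ := bind₁_eq_self (by simp) hp₀
  -- `u` inverts the affine map `a₀ x + p₀`, so `m(y) = p₁(u(y))` is sent by `f` to `p₁(x)`.
  -- Replacing the coordinate `z` by `z - m(y)` thus removes `p₁` from the last component.
  set u : MvPolynomial (Fin 3) k := C a₀⁻¹ * (X 1 - p₀) with hu
  set m : MvPolynomial (Fin 3) k := bind₁ (fun _ : Fin 3 => u) p₁ with hm
  have hmS : m ∈ supported k {1} := by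
    refine bind₁_mem_supported (S := {0}) (fun j _ => C_mul_mem_supported _ ?_) hp₁
    exact sub_mem (X_mem_supported.2 rfl) (supported_mono (Set.empty_subset _) hp₀)
  let φ : PolyEnd k 3 := ![X 0, X 1, X 2 - m]
  let ψ : PolyEnd k 3 := ![X 0, X 1, X 2 + m]
  have fix_φ : bind₁ φ m = m := bind₁_eq_self (by simp [φ]) hmS
  have fix_ψ : bind₁ ψ m = m := bind₁_eq_self (by simp [ψ]) hmS
  have h21 : comp ψ φ = one k 3 := by
    funext i
    fin_cases i
    · simp [comp, φ, ψ, one]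
    · simp [comp, φ, ψ, one]
    · change bind₁ φ (X 2 + m) = X 2
      rw [map_add, fix_φ]
      simp [φ]
  have h12 : comp φ ψ = one k 3 := by
    funext i
    fin_cases i
    · simp [comp, φ, ψ, one]
    · simp [comp, φ, ψ, one]
    · change bind₁ ψ (X 2 - m) = X 2
      rw [map_sub, fix_ψ]
      simp [ψ]
  have g0 : comp f ψ 0 = C a₂ * X 2 + (C a₂ * m + p₂) := by
    have : bind₁ ψ p₂ = p₂ := bind₁_eq_self (by simp [ψ]) hp₂
    simp only [comp, h0, e₂, map_add, map_mul, bind₁_C_right, bind₁_X_right, this]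
    simp only [ψ, Matrix.cons_val]
    ring
  have g1 : comp f ψ 1 = C a₀ * X 0 + p₀ := by
    simp only [comp, h1, e₀, map_add, map_mul, bind₁_C_right, bind₁_X_right, fix₀]
    simp [ψ]
  have g2 : comp f ψ 2 = C a₁ * X 1 + p₁ := by
    have : bind₁ ψ p₁ = p₁ := bind₁_eq_self (by simp [ψ]) hp₁
    simp only [comp, h2, e₁, map_add, map_mul, bind₁_C_right, bind₁_X_right, this]
    simp [ψ]
  have hbm : bind₁ (comp f ψ) m = p₁ := by
    rw [hm, bind₁_bind₁]
    refine bind₁_eq_self (S := {0}) (fun i hi => ?_) hp₁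
    rw [Set.mem_singleton_iff.1 hi, hu]
    have e : (C a₀⁻¹ * C a₀ : MvPolynomial (Fin 3) k) = 1 := by
      rw [← C_mul, inv_mul_cancel₀ ha₀, C_1]
    simp only [map_sub, map_mul, bind₁_C_right, bind₁_X_right, fix₀, g1]
    linear_combination X 0 * e
  refine (h.conj h21 h12).exists_of_shift hl (q := C a₂ * m + p₂) ha₀ ?_ hp₀ (zero_mem _) (b := a₂)
    (c := a₁) ?_ ?_ ?_
  · exact add_mem (C_mul_mem_supported _ (supported_mono (by simp) hmS)) hp₂
  · change bind₁ (comp f ψ) (X 0) = _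
    rw [bind₁_X_right, g0]
  · change bind₁ (comp f ψ) (X 1) = _
    rw [bind₁_X_right, g1]
  · change bind₁ (comp f ψ) (X 2 - m) = _
    rw [map_sub, bind₁_X_right, g2, hbm]
    ring

/-- The cyclic permutation `(τ₂, τ₃, τ₁)`. -/
theorem HasDynamicalDegree.exists_of_inverse_cycle {τ f : PolyEnd k 3} (hτ : IsDeJonquieres τ)
    {l : ℝ} (h : f.HasDynamicalDegree l) (hl : 1 < l) (h0 : f 0 = τ 1) (h1 : f 1 = τ 2)
    (h2 : f 2 = τ 0) : ∃ i j : ℕ, l ^ 2 = i * l + j := by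
  obtain ⟨a₀, ha₀, p₀, hp₀, e₀⟩ := hτ 0
  obtain ⟨a₁, ha₁, p₁, hp₁, e₁⟩ := hτ 1
  obtain ⟨a₂, ha₂, p₂, hp₂, e₂⟩ := hτ 2
  -- The new coordinates are `(τ 1, x, z)`: since `f 0 = τ 1`, the new second coordinate is mapped
  -- to the new first one.
  let φ' : PolyEnd k 3 := ![X 0, τ 1, X 2]
  have hφ' : IsDeJonquieres φ' := by
    intro i
    fin_cases i
    · exact ⟨1, one_ne_zero, 0, zero_mem _, by simp [φ']⟩
    · exact hτ 1
    · exact ⟨1, one_ne_zero, 0, zero_mem _, by simp [φ']⟩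
  obtain ⟨ψ, h12, h21⟩ := (perm_isAut (Equiv.swap (0 : Fin 3) 1)).comp hφ'.isAut
  set φ := comp (perm k (Equiv.swap (0 : Fin 3) 1)) φ' with hφ
  have φ0 : φ 0 = τ 1 := by rw [hφ, perm_comp]; simp [φ']
  have φ1 : φ 1 = X 0 := by rw [hφ, perm_comp]; simp [φ']
  have φ2 : φ 2 = X 2 := by
    rw [hφ, perm_comp]
    simp only [Equiv.swap_apply_of_ne_of_ne (show (2 : Fin 3) ≠ 0 by decide)
      (show (2 : Fin 3) ≠ 1 by decide)]
    simp [φ']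
  rw [Iio_zero_fin_three] at hp₀
  rw [Iio_one_fin_three] at hp₁
  rw [Iio_two_fin_three] at hp₂
  have ψτ : bind₁ ψ (τ 1) = X 0 := by
    have := congrFun h12 0
    rwa [comp, φ0] at this
  have ψ0 : ψ 0 = X 1 := by
    have := congrFun h12 1
    rwa [comp, φ1, bind₁_X_right] at this
  have ψ2 : ψ 2 = X 2 := by
    have := congrFun h12 2
    rwa [comp, φ2, bind₁_X_right] at this
  have hψp₁ : bind₁ ψ p₁ ∈ supported k {0, 1} := by
    refine bind₁_mem_supported (fun j hj => ?_) hp₁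
    rw [Set.mem_singleton_iff.1 hj, ψ0]
    exact X_mem_supported.2 (by simp)
  have ψ1 : ψ 1 ∈ supported k {0, 1} := by
    have e : (C a₁⁻¹ * C a₁ : MvPolynomial (Fin 3) k) = 1 := by
      rw [← C_mul, inv_mul_cancel₀ ha₁, C_1]
    have : ψ 1 = C a₁⁻¹ * (X 0 - bind₁ ψ p₁) := by
      rw [← ψτ, e₁, map_add, map_mul, bind₁_C_right, bind₁_X_right]
      linear_combination -ψ 1 * e
    rw [this]
    exact C_mul_mem_supported _ (sub_mem (X_mem_supported.2 (by simp)) hψp₁)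
  have hψp₂ : bind₁ ψ p₂ ∈ supported k {0, 1} := by
    refine bind₁_mem_supported (fun j hj => ?_) hp₂
    rcases hj with rfl | rfl
    · rw [ψ0]
      exact X_mem_supported.2 (by simp)
    · exact ψ1
  have g0 : comp f ψ 0 = X 0 := by rw [comp, h0, ψτ]
  have g1 : comp f ψ 1 = C a₂ * X 2 + bind₁ ψ p₂ := by
    simp only [comp, h1, e₂, map_add, map_mul, bind₁_C_right, bind₁_X_right, ψ2]
  have g2 : comp f ψ 2 = C a₀ * X 1 + bind₁ ψ p₀ := by
    simp only [comp, h2, e₀, map_add, map_mul, bind₁_C_right, bind₁_X_right, ψ0]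
  refine (h.conj h21 h12).exists_of_shift hl (a := 1) (b := a₁ * a₂) (c := a₀)
    (q := C a₁ * bind₁ ψ p₂ + bind₁ (comp f ψ) p₁) (p := 0) (r := bind₁ ψ p₀) one_ne_zero ?_
    (zero_mem _) (bind₁_mem_supported (by simp) hp₀) ?_ ?_ ?_
  · refine add_mem (C_mul_mem_supported _ hψp₂) (bind₁_mem_supported (fun j hj => ?_) hp₁)
    rw [Set.mem_singleton_iff.1 hj, g0]
    exact X_mem_supported.2 (by simp)
  · rw [comp, φ0, e₁, map_add, map_mul, bind₁_C_right, bind₁_X_right, g1, C_mul]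
    ring
  · rw [comp, φ1, bind₁_X_right, g0]
    simp
  · rw [comp, φ2, bind₁_X_right, g2]

/-- The transposition `(τ₃, τ₂, τ₁)`. -/
theorem HasDynamicalDegree.exists_of_transposition {τ f : PolyEnd k 3} (hτ : IsDeJonquieres τ)
    {l : ℝ} (h : f.HasDynamicalDegree l) (hl : 1 < l) (h0 : f 0 = τ 2) (h1 : f 1 = τ 1)
    (h2 : f 2 = τ 0) : ∃ i j : ℕ, l ^ 2 = i * l + j := by
  have c0 (d) (hd : coeff d (f 2) ≠ 0) : d 0 ≤ 1 ∧ d 1 = 0 ∧ d 2 = 0 := by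
    rw [h2] at hd
    rcases hτ.coeff_cases hd with rfl | hd <;> simp_all
  have c1 (d) (hd : coeff d (f 1) ≠ 0) :
      (d 0 = 0 ∧ d 1 = 1 ∧ d 2 = 0) ∨ (d 1 = 0 ∧ d 2 = 0) := by
    rw [h1] at hd
    rcases hτ.coeff_cases hd with rfl | hd
    · simp
    · exact Or.inr ⟨hd 1 le_rfl, hd 2 (by decide)⟩
  have c2 (d) (hd : coeff d (f 0) ≠ 0) : (d 0 = 0 ∧ d 1 = 0 ∧ d 2 = 1) ∨ d 2 = 0 := by
    rw [h0] at hd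
    rcases hτ.coeff_cases hd with rfl | hd
    · simp
    · exact Or.inr (hd 2 le_rfl)
  obtain ⟨e, he, d₀, hd₀, hd₀e⟩ := exists_max_exponent (h1 ▸ hτ.ne_zero 1 : f 1 ≠ 0) 0
  -- If `f 1` does not involve `x`, the map fibres over the `y`-line; otherwise its degree `e ≥ 1`
  -- in `x` enters the recurrence.
  rcases Nat.eq_zero_or_pos e with rfl | hpos
  · suffices hD : ∃ D : ℕ, l = D by
      obtain ⟨D, rfl⟩ := hD
      exact ⟨D, 0, by simp [sq]⟩
    refine h.eq_natCast_of_fibred hl (s := 1) (u := 0) (v := 2) (by decide)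
      (by decide) (by decide) (fun d hd => ?_) ⟨Finsupp.single 1 1, ?_, by simp⟩ (fun d hd => ?_)
      (h0 ▸ hτ.ne_zero 2) fun d hd => ?_
    · have := he d hd
      rcases c1 d hd with hd | hd <;> omega
    · rw [h1]
      exact hτ.coeff_single 1
    · rcases c2 d hd with hd | hd <;> omega
    · have := c0 d hd
      omega
  · refine h.exists_of_recurrence hl hpos c2 (fun d hd => ?_) ⟨d₀, hd₀, hd₀e⟩
      fun d hd => Or.inl (c0 d hd)
    have := he d hd
    rcases c1 d hd with hd | hd <;> omega

theorem dynamicalDegree_of_dim_three {f : PolyEnd k 3} {l : ℝ} (h : f.HasDynamicalDegree l)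
    (hf : IsAut f) (hf' : IsAffineTriangular f) (hl : 1 < l) :
    ∃ i j : ℕ, l ^ 2 = i * l + j := by
  obtain ⟨τ, π, hτ, h'⟩ := h.exists_normalForm hf hf'
  have hπ : ∀ π : Equiv.Perm (Fin 3), π = 1 ∨ (π 0 = 1 ∧ π 1 = 0 ∧ π 2 = 2) ∨
      (π 0 = 0 ∧ π 1 = 2 ∧ π 2 = 1) ∨ (π 0 = 2 ∧ π 1 = 1 ∧ π 2 = 0) ∨
      (π 0 = 2 ∧ π 1 = 0 ∧ π 2 = 1) ∨ (π 0 = 1 ∧ π 1 = 2 ∧ π 2 = 0) := by decide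
  rcases hπ π with rfl | ⟨h0, h1, h2⟩ | ⟨h0, h1, h2⟩ | ⟨h0, h1, h2⟩ | ⟨h0, h1, h2⟩ | ⟨h0, h1, h2⟩
  · exact absurd (hτ.dynamicalDegree_le_one h') (not_le.2 hl)
  · suffices hD : ∃ D : ℕ, l = D by
      obtain ⟨D, rfl⟩ := hD
      exact ⟨D, 0, by simp [sq]⟩
    refine h'.eq_natCast_of_henon hl (s := 0) (u := 1) (by decide) (fun d hd => ?_)
      (hτ.ne_zero _) (fun d hd => ?_) fun v hv0 hv1 d hd => ?_
    · simp only [h0] at hd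
      refine (hτ.coeff_cases hd).imp id fun h v hv => h v ?_
      omega
    · simp only [h1] at hd
      exact (hτ.coeff_cases hd).imp id fun h => Finsupp.ext fun v => h v (Fin.zero_le v)
    · obtain rfl : v = 2 := by omega
      simp only [h2] at hd
      refine (hτ.coeff_cases hd).imp id fun h x hx0 hx1 => h x ?_
      omega
  · suffices hD : ∃ D : ℕ, l = D by
      obtain ⟨D, rfl⟩ := hD
      exact ⟨D, 0, by simp [sq]⟩
    refine h'.eq_natCast_of_fibred hl (s := 0) (u := 1) (v := 2) (by decide)
      (by decide) (by decide) (fun d hd => ?_) ⟨Finsupp.single 0 1, ?_, by simp⟩ (fun d hd => ?_)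
      (hτ.ne_zero _) fun d hd => ?_
    · simp only [h0] at hd
      rcases hτ.coeff_cases hd with rfl | hd <;> simp_all
    · simp only [h0]
      exact hτ.coeff_single 0
    · simp only [h1] at hd
      rcases hτ.coeff_cases hd with rfl | hd
      · simp
      · exact Or.inr (hd 2 le_rfl)
    · simp only [h2] at hd
      rcases hτ.coeff_cases hd with rfl | hd
      · simp
      · exact Or.inr ⟨hd 1 le_rfl, hd 2 (by decide)⟩
  · exact h'.exists_of_transposition hτ hl (by simp [h0]) (by simp [h1]) (by simp [h2])
  · exact h'.exists_of_cycle hτ hl (by simp [h0]) (by simp [h1]) (by simp [h2])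
  · exact h'.exists_of_inverse_cycle hτ hl (by simp [h0]) (by simp [h1]) (by simp [h2])

end PolyEnd

end AffineDyn

/-! ### Constructions from positive eigenvectors. -/

namespace AffineDyn

open MvPolynomial

namespace PolyEnd

variable {k : Type*} [Field k] {n : ℕ}

theorem perm_isAffineAut (hn : 1 ≤ n) (π : Equiv.Perm (Fin n)) : IsAffineAut (perm k π) := by
  refine ⟨perm_isAut π, le_antisymm (Finset.sup_le fun i _ => (totalDegree_X _).le) ?_⟩
  have := totalDegree_le_degree (perm k π) ⟨0, hn⟩
  rwa [perm, totalDegree_X] at this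

/-- Substituting monomials never produces zero, so monomial leading parts need not be dominant, and
singular exponent matrices are allowed. -/
theorem iter_monomial_ne_zero (m : Fin n → Fin n →₀ ℕ) (r : ℕ) (i : Fin n) :
    iter (fun i => (monomial (m i) 1 : MvPolynomial (Fin n) k)) r i ≠ 0 := by
  induction r generalizing i with
  | zero => exact X_ne_zero i
  | succ r ih =>
    rw [iter, comp, bind₁_monomial, C_1, one_mul]
    exact Finset.prod_ne_zero_iff.2 fun j _ => pow_ne_zero _ (ih j)

end PolyEnd

open PolyEnd

variable {k : Type*} [Field k] {n : ℕ}

/-- A triangular automorphism followed by a permutation of the coordinates, whose leading part for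
some weights is monomial. -/
theorem mem_realizingDims_of_weights (hn : 1 ≤ n) (π : Equiv.Perm (Fin n))
    {h : Fin n → MvPolynomial (Fin n) k} (hh : ∀ i, h i ∈ supported k (Set.Iio i))
    {w : Fin n → ℝ} (hw : ∀ i, 0 < w i) {t : ℝ} (ht : 0 < t)
    (hlead : ∀ i, (h (π i) = 0 ∧ w (π i) = t * w i) ∨
      ∃ m, h (π i) = monomial m 1 ∧ Finsupp.weight w m = t * w i ∧ w (π i) < t * w i) :
    n ∈ realizingDims k t := by
  set τ : PolyEnd k n := fun i => X i + h i with hτ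
  have hτJ : IsDeJonquieres τ := fun i => ⟨1, one_ne_zero, h i, hh i, by simp [hτ]⟩
  have hm (i : Fin n) : ∃ m, HasLead w (t * w i) (τ (π i)) (monomial m 1) := by
    rcases hlead i with ⟨h0, hwi⟩ | ⟨m, hm, hwm, hlt⟩
    · refine ⟨Finsupp.single (π i) 1, X_mem_weightSub hwi, ?_⟩
      have : τ (π i) - monomial (Finsupp.single (π i) 1) 1 = 0 := by
        simp only [hτ, h0, add_zero]
        exact sub_self _
      rw [this]
      exact zero_mem _
    · refine ⟨m, monomial_mem_weightSub _ hwm, ?_⟩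
      have : τ (π i) - monomial m 1 = X (π i) := by simp [hτ, hm]
      rw [this]
      exact X_mem_weightSub hlt
  choose m hm using hm
  have e : comp (perm k π) τ = fun i => τ (π i) := perm_comp π τ
  refine ⟨hn, comp (perm k π) τ, (perm_isAut π).comp hτJ.isAut,
    ⟨perm k π, τ, perm_isAffineAut hn π, hτJ.isTriangular, rfl⟩, ?_⟩
  rw [e]
  obtain ⟨C, hC, hd⟩ := exists_le_degree_iter (f := fun i => τ (π i))
    (g := fun i => monomial (m i) 1) ht (fun i => (hw i).le) hm
    (hw ⟨0, hn⟩) fun r => iter_monomial_ne_zero m r _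
  obtain ⟨C', hC', hd'⟩ := exists_degree_iter_le (f := fun i => τ (π i)) ht.le hw
    fun i => (hm i).mem_Iic
  exact hasDynamicalDegree_of_bounds hC hC' ht.le hd hd'

theorem monomial_mem_supported {S : Set (Fin n)} {m : Fin n →₀ ℕ} (h : ∀ v, m v ≠ 0 → v ∈ S) :
    (monomial m 1 : MvPolynomial (Fin n) k) ∈ supported k S := by
  classical
  refine mem_supported_iff_coeff.2 fun d hd => ?_
  rw [coeff_monomial] at hd
  rw [← (ite_ne_right_iff.1 hd).1]
  exact h

theorem one_mem_realizingDims : 1 ∈ realizingDims k 1 :=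
  mem_realizingDims_of_weights le_rfl 1 (h := 0) (fun _ => zero_mem _) (w := 1) (by simp) one_pos
    (by simp)

/-- Realized by the Hénon map `(y + x ^ D, x)` with weights `(D, 1)`. -/
theorem two_mem_realizingDims {D : ℕ} (hD : 2 ≤ D) : 2 ∈ realizingDims k (D : ℝ) := by
  have hD' : (2 : ℝ) ≤ D := by exact_mod_cast hD
  refine mem_realizingDims_of_weights (by norm_num) (Equiv.swap 0 1)
    (h := ![0, monomial (Finsupp.single 0 D) 1]) (fun i => ?_) (w := ![D, 1]) (fun i => ?_)
    (by linarith) fun i => ?_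
  · fin_cases i
    · exact zero_mem _
    · refine monomial_mem_supported fun v hv => ?_
      by_contra h
      exact hv (Finsupp.single_eq_of_ne fun h' => h (h' ▸ by simp))
  · fin_cases i
    · change (0 : ℝ) < D
      linarith
    · exact one_pos
  · fin_cases i
    · refine Or.inr ⟨Finsupp.single 0 D, by simp, by simp [Finsupp.weight_single], ?_⟩
      simp only [Fin.zero_eta, Equiv.swap_apply_left, Matrix.cons_val_zero, Matrix.cons_val_one]
      nlinarith
    · exact Or.inl (by simp)

/-- Realized by `(z + x ^ a * y ^ b, x, y)` with weights `(l, 1, l⁻¹)`; the equation for `l` says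
that `x ^ a * y ^ b` has weight `l * l`. -/
theorem three_mem_realizingDims {l : ℝ} (hl : 1 < l) {a b : ℕ} (h : l ^ 2 = a * l + b) :
    3 ∈ realizingDims k l := by
  have hl0 : 0 < l := by linarith
  set m : Fin 3 →₀ ℕ := Finsupp.single 0 a + Finsupp.single 1 b with hm
  refine mem_realizingDims_of_weights (by norm_num) (finRotate 3).symm
    (h := ![0, 0, monomial m 1]) (fun i => ?_) (w := ![l, 1, l⁻¹]) (fun i => ?_) hl0 fun i => ?_
  · fin_cases i
    · exact zero_mem _
    · exact zero_mem _
    · refine monomial_mem_supported fun v hv => ?_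
      fin_cases v
      · decide
      · decide
      · simp [hm] at hv
  · fin_cases i
    · exact hl0
    · exact one_pos
    · exact inv_pos.2 hl0
  · have r0 : (finRotate 3).symm 0 = 2 := by decide
    have r1 : (finRotate 3).symm 1 = 0 := by decide
    have r2 : (finRotate 3).symm 2 = 1 := by decide
    fin_cases i
    · refine Or.inr ⟨m, ?_, ?_, ?_⟩
      · simp [r0]
      · simp only [hm, map_add, Finsupp.weight_single]
        simp
        linarith
      · simp only [Fin.zero_eta, r0, Matrix.cons_val]
        have : l⁻¹ < 1 := inv_lt_one_of_one_lt₀ hl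
        nlinarith
    · left
      simp [r1]
    · left
      simp [r2, hl0.ne']

/-- A nonnegative integer matrix with a positive eigenvector realizes its eigenvalue. -/
theorem add_self_mem_realizingDims {N : ℕ} (hN : 1 ≤ N) {l : ℝ} (hl : 1 < l)
    (M : Fin N → Fin N → ℕ) {u : Fin N → ℝ} (hu : ∀ i, 0 < u i)
    (hM : ∀ i, ∑ j, M i j * u j = l * u i) : N + N ∈ realizingDims k l := by
  have hl0 : 0 < l := by linarith
  -- The map is `(y + x ^ M, x)` on two blocks of `N` variables, with weights `u` and `l⁻¹ * u`. The
  -- second block makes any monomial in the first one admissible in a triangular map.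
  let m : Fin N → Fin (N + N) →₀ ℕ := fun i =>
    Finsupp.equivFunOnFinite.symm (Fin.append (M i) 0)
  refine mem_realizingDims_of_weights (by omega) finAddFlip
    (h := Fin.append 0 fun i => monomial (m i) 1) (fun i => ?_)
    (w := Fin.append u fun i => l⁻¹ * u i) (fun i => ?_) hl0 fun i => ?_
  · induction i using Fin.addCases with
    | left i =>
      rw [Fin.append_left]
      exact zero_mem _
    | right i =>
      rw [Fin.append_right]
      refine monomial_mem_supported fun v hv => ?_
      induction v using Fin.addCases with
      | left v =>
        rw [Set.mem_Iio, Fin.lt_def]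
        simp only [Fin.val_castAdd, Fin.val_natAdd]
        omega
      | right v => simp [m, -Fin.natAdd_eq_addNat] at hv
  · induction i using Fin.addCases with
    | left i => simpa using hu i
    | right i =>
      rw [Fin.append_right]
      have := hu i
      positivity
  · induction i using Fin.addCases with
    | left i =>
      refine Or.inr ⟨m i, ?_, ?_, ?_⟩
      · simp [finAddFlip_apply_castAdd, -Fin.natAdd_eq_addNat]
      · rw [Finsupp.weight_eq_sum, Fin.sum_univ_add]
        simp [m, hM, -Fin.natAdd_eq_addNat]
      · simp only [finAddFlip_apply_castAdd, Fin.append_right, Fin.append_left]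
        have : l⁻¹ < 1 := inv_lt_one_of_one_lt₀ hl
        have := hu i
        nlinarith
    | right i =>
      left
      simp [finAddFlip_apply_natAdd, hl0.ne', -Fin.natAdd_eq_addNat]

end AffineDyn

/-! ### Weak Perron numbers as eigenvalues of nonnegative integer matrices. -/

namespace AffineDyn

section MaximalModulus

open Polynomial

/-- The conjugates of maximal modulus of a weak Perron number have a common power. -/
theorem IsWeakPerron.exists_pow_eq {l : ℝ} (hl : IsWeakPerron l) :
    ∃ m : ℕ, 0 < m ∧ ∀ μ : ℂ, IsConjugateOf μ l → ‖μ‖ = l → μ ^ m = (l : ℂ) ^ m := by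
  classical
  obtain ⟨hl1, hint, hconj⟩ := hl
  have hl0 : 0 < l := by linarith
  have hintQ : IsIntegral ℚ l := hint.tower_top
  set P := minpoly ℚ l with hP
  have hP0 : P ≠ 0 := minpoly.ne_zero hintQ
  have hroot_l : aeval (l : ℂ) P = 0 := by
    have := aeval_algebraMap_apply ℂ l P
    rw [minpoly.aeval, map_zero] at this
    exact this
  have hle (μ : ℂ) (hμ : aeval μ P = 0) : ‖μ‖ ≤ l := by
    by_cases h : μ = l
    · rw [h, Complex.norm_of_nonneg hl0.le]
    · exact hconj μ hμ h
  set s : Finset ℂ := (P.aroots ℂ).toFinset.filter fun μ => ‖μ‖ = l with hs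
  have mem_s (μ : ℂ) : μ ∈ s ↔ aeval μ P = 0 ∧ ‖μ‖ = l := by
    simp [hs, hP0]
  have hls : (l : ℂ) ∈ s := (mem_s _).2 ⟨hroot_l, Complex.norm_of_nonneg hl0.le⟩
  have hcard : 0 < s.card := Finset.card_pos.2 ⟨_, hls⟩
  set p : ℂ := ∏ μ ∈ s, μ with hp
  -- The set `s` of conjugates of modulus `l` is stable under complex conjugation, so `p` is real
  -- with absolute value `l ^ s.card`.
  have hpsq : p ^ 2 = (l : ℂ) ^ (2 * s.card) := by
    have hconj_p : (starRingEnd ℂ) p = p := by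
      rw [hp, map_prod]
      refine Finset.prod_bij' (fun μ _ => (starRingEnd ℂ) μ) (fun μ _ => (starRingEnd ℂ) μ)
        ?_ ?_ ?_ ?_ ?_
      · intro μ hμ
        obtain ⟨h1, h2⟩ := (mem_s μ).1 hμ
        refine (mem_s _).2 ⟨?_, by rw [Complex.norm_conj, h2]⟩
        have := aeval_algHom_apply (Complex.conjAe.restrictScalars ℚ : ℂ ≃ₐ[ℚ] ℂ) μ P
        rw [h1, map_zero] at this
        exact this
      · intro μ hμ
        obtain ⟨h1, h2⟩ := (mem_s μ).1 hμ
        refine (mem_s _).2 ⟨?_, by rw [Complex.norm_conj, h2]⟩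
        have := aeval_algHom_apply (Complex.conjAe.restrictScalars ℚ : ℂ ≃ₐ[ℚ] ℂ) μ P
        rw [h1, map_zero] at this
        exact this
      · simp
      · simp
      · simp
    have hnorm : ‖p‖ = l ^ s.card := by
      rw [hp, norm_prod, Finset.prod_congr rfl fun μ hμ => ((mem_s μ).1 hμ).2, Finset.prod_const]
    have h1 : p * (starRingEnd ℂ) p = ((‖p‖ ^ 2 : ℝ) : ℂ) := by
      rw [Complex.mul_conj, Complex.normSq_eq_norm_sq]
    rw [hconj_p, hnorm] at h1
    rw [sq, h1]
    push_cast
    ring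
  have halg {μ : ℂ} (hμ : aeval μ P = 0) : μ ∈ algebraicClosure ℚ ℂ :=
    mem_algebraicClosure_iff.2 ⟨P, hP0, hμ⟩
  refine ⟨2 * s.card, by omega, fun α hα hαn => ?_⟩
  -- Applying an embedding with `l ↦ α` to the relation for `p ^ 2` gives `α ^ (2 * s.card)` on the
  -- right. Comparing moduli, every conjugate in `s` must be sent to one of modulus `l`; hence `s`
  -- is permuted, `p` is fixed, and the two powers agree.
  obtain ⟨σ, hσ⟩ : ∃ σ : algebraicClosure ℚ ℂ →ₐ[ℚ] ℂ, σ ⟨l, halg hroot_l⟩ = α := by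
    refine IntermediateField.exists_algHom_of_splits_of_aeval
      (fun x => ⟨((algebraicClosure.isAlgebraic ℚ ℂ).isAlgebraic x).isIntegral,
        IsAlgClosed.splits _⟩) ?_
    have h1 : minpoly ℚ (⟨l, halg hroot_l⟩ : algebraicClosure ℚ ℂ) = P := by
      rw [← minpoly.algebraMap_eq (algebraMap (algebraicClosure ℚ ℂ) ℂ).injective]
      exact minpoly.algebraMap_eq (algebraMap ℝ ℂ).injective l
    have h2 : aeval α P = 0 := hα
    rw [← h1] at h2
    convert h2
    · rfl
    · exact Subsingleton.elim _ _
  let T : ℂ → ℂ := fun μ => if h : aeval μ P = 0 then σ ⟨μ, halg h⟩ else μ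
  have hT {μ : ℂ} (h : aeval μ P = 0) : T μ = σ ⟨μ, halg h⟩ := dif_pos h
  have hTroot {μ : ℂ} (h : aeval μ P = 0) : aeval (T μ) P = 0 := by
    rw [hT h, aeval_algHom_apply]
    have : aeval (⟨μ, halg h⟩ : algebraicClosure ℚ ℂ) P = 0 := by
      apply (algebraMap (algebraicClosure ℚ ℂ) ℂ).injective
      rw [map_zero, ← aeval_algebraMap_apply]
      exact h
    rw [this, map_zero]
  have hTinj : Set.InjOn T s := by
    intro x hx y hy hxy
    have hx' := ((mem_s x).1 hx).1
    have hy' := ((mem_s y).1 hy).1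
    rw [hT hx', hT hy'] at hxy
    exact congrArg Subtype.val (σ.toRingHom.injective hxy)
  set q : algebraicClosure ℚ ℂ :=
    ∏ μ ∈ s.attach, ⟨μ.1, halg ((mem_s _).1 μ.2).1⟩ with hq
  have hqp : (q : ℂ) = p := by
    rw [hq, hp, ← Finset.prod_attach s, ← IntermediateField.algebraMap_apply, map_prod]
    rfl
  have hqsq : q ^ 2 = (⟨l, halg hroot_l⟩ : algebraicClosure ℚ ℂ) ^ (2 * s.card) := by
    apply Subtype.ext
    push_cast
    rw [hqp, hpsq]
  have hσq : σ q = ∏ μ ∈ s, T μ := by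
    rw [hq, map_prod, ← Finset.prod_attach s]
    exact Finset.prod_congr rfl fun μ _ => (hT ((mem_s _).1 μ.2).1).symm
  have hσsq : (∏ μ ∈ s, T μ) ^ 2 = α ^ (2 * s.card) := by
    rw [← hσq, ← map_pow, hqsq, map_pow, hσ]
  have hprodnorm : ∏ μ ∈ s, ‖T μ‖ = ∏ _μ ∈ s, l := by
    rw [Finset.prod_const, ← norm_prod]
    have := congrArg norm hσsq
    rw [norm_pow, norm_pow, hαn, mul_comm, pow_mul] at this
    exact (pow_left_inj₀ (norm_nonneg _) (by positivity) two_ne_zero).1 this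
  have hTnorm : ∀ μ ∈ s, ‖T μ‖ = l := by
    by_contra hcon
    push Not at hcon
    obtain ⟨μ, hμ, hne⟩ := hcon
    have hpos : ∀ ν ∈ s, 0 < ‖T ν‖ := by
      intro ν hν
      rw [norm_pos_iff]
      intro h0
      have : ∏ μ ∈ s, ‖T μ‖ = 0 := Finset.prod_eq_zero hν (by rw [h0, norm_zero])
      rw [hprodnorm, Finset.prod_const] at this
      exact (pow_pos hl0 _).ne' this
    have hle' : ∀ ν ∈ s, ‖T ν‖ ≤ l := fun ν hν => hle _ (hTroot ((mem_s ν).1 hν).1)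
    exact absurd hprodnorm
      (Finset.prod_lt_prod hpos hle' ⟨μ, hμ, lt_of_le_of_ne (hle' μ hμ) hne⟩).ne
  have himage : s.image T = s := by
    refine Finset.eq_of_subset_of_card_le (fun x hx => ?_) (Finset.card_image_of_injOn hTinj).ge
    obtain ⟨μ, hμ, rfl⟩ := Finset.mem_image.1 hx
    exact (mem_s _).2 ⟨hTroot ((mem_s μ).1 hμ).1, hTnorm μ hμ⟩
  have hprod : ∏ μ ∈ s, T μ = p := by
    conv_rhs => rw [hp, ← himage]
    exact (Finset.prod_image (f := fun x => x) hTinj).symm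
  rw [← hσsq, hprod, hpsq]

end MaximalModulus

section Semigroup

variable {K : Type*} [Field K] [NumberField K]

open Algebra

/-- The part number `i` of `y = ∑ c s • s` when it is divided into `q` nearly equal parts. -/
theorem exists_near_equal_parts (S : Finset K) (c : K → ℤ) {q : ℕ} (hq : 0 < q) :
    ∃ y : ℕ → K, (∀ i, y i ∈ Submodule.span ℤ (S : Set K)) ∧
      ∑ i ∈ Finset.range q, y i = ∑ s ∈ S, c s • s ∧
      ∀ (φ : K →+* ℂ) (i : ℕ),
        ‖φ (y i) - φ (∑ s ∈ S, c s • s) / q‖ ≤ ∑ s ∈ S, ‖φ s‖ := by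
  have hq' : (0 : ℤ) < q := by exact_mod_cast hq
  have hqR : (0 : ℝ) < q := by exact_mod_cast hq
  -- Floors of `i * c s / q`: their consecutive differences are within 1 of `c s / q` and telescope
  -- to `c s`.
  let g : ℕ → K → ℤ := fun i s => (i * c s) / q
  let F : ℕ → K := fun i => ∑ s ∈ S, g i s • s
  have hg (i : ℕ) (s : K) : |((g (i + 1) s - g i s : ℤ) : ℝ) - c s / q| ≤ 1 := by
    have h1 : (g i s : ℝ) * q ≤ i * c s := by exact_mod_cast Int.ediv_mul_le (i * c s) hq'.ne'
    have h2 : (i * c s : ℝ) < (g i s + 1) * q := by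
      exact_mod_cast Int.lt_ediv_add_one_mul_self (i * c s) hq'
    have h3 : (g (i + 1) s : ℝ) * q ≤ (i + 1) * c s := by
      exact_mod_cast Int.ediv_mul_le (((i + 1 : ℕ) : ℤ) * c s) hq'.ne'
    have h4 : ((i + 1) * c s : ℝ) < (g (i + 1) s + 1) * q := by
      exact_mod_cast Int.lt_ediv_add_one_mul_self (((i + 1 : ℕ) : ℤ) * c s) hq'
    have e : (c s : ℝ) = c s / q * q := (div_mul_cancel₀ _ hqR.ne').symm
    set x : ℝ := c s / q
    rw [e] at h1 h2 h3 h4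
    have h1' : (g i s : ℝ) ≤ i * x := le_of_mul_le_mul_right (by linarith) hqR
    have h2' : (i * x : ℝ) < g i s + 1 := lt_of_mul_lt_mul_right (by linarith) hqR.le
    have h3' : (g (i + 1) s : ℝ) ≤ (i + 1) * x := le_of_mul_le_mul_right (by linarith) hqR
    have h4' : ((i + 1) * x : ℝ) < g (i + 1) s + 1 := lt_of_mul_lt_mul_right (by linarith) hqR.le
    push_cast
    rw [abs_le]
    constructor <;> linarith
  refine ⟨fun i => F (i + 1) - F i, fun i => ?_, ?_, fun φ i => ?_⟩
  · have hF (i : ℕ) : F i ∈ Submodule.span ℤ (S : Set K) :=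
      Submodule.sum_mem _ fun s hs => Submodule.smul_mem _ _ (Submodule.subset_span hs)
    exact Submodule.sub_mem _ (hF _) (hF _)
  · rw [Finset.sum_range_sub F q]
    simp [F, g, Int.mul_ediv_cancel_left _ hq'.ne']
  · have e : φ (F (i + 1) - F i) - φ (∑ s ∈ S, c s • s) / q =
        ∑ s ∈ S, ((((g (i + 1) s - g i s : ℤ) : ℝ) - c s / q : ℝ) : ℂ) * φ s := by
      simp only [F, map_sub, map_sum, zsmul_eq_mul, map_mul, map_intCast]
      rw [← Finset.sum_sub_distrib, Finset.sum_div, ← Finset.sum_sub_distrib]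
      refine Finset.sum_congr rfl fun s _ => ?_
      push_cast
      ring
    simp only
    rw [e]
    refine (norm_sum_le _ _).trans (Finset.sum_le_sum fun s _ => ?_)
    rw [norm_mul, Complex.norm_real]
    exact mul_le_of_le_one_left (norm_nonneg _) (hg i s)

theorem map_eq_of_mem_adjoin {ι : K →+* ℝ} {β : K} {φ : K →+* ℂ} (h : φ β = ι β) {z : K}
    (hz : z ∈ adjoin ℤ {β}) : φ z = ι z := by
  induction hz using adjoin_induction with
  | mem x hx => rw [Set.mem_singleton_iff.1 hx, h]
  | algebraMap r => simp
  | add x y _ _ hx hy => simp [hx, hy]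
  | mul x y _ _ hx hy => simp [hx, hy]

/-- An algebraic integer that dominates its conjugates stabilizes a finitely generated semigroup of
positive elements. -/
theorem exists_finset_mul_mem_span (ι : K →+* ℝ) {β : K} (hβ : IsIntegral ℤ β) (hpos : 0 < ι β)
    (hdom : ∀ φ : K →+* ℂ, φ β = ι β ∨ ‖φ β‖ < ι β) :
    ∃ F : Finset K, F.Nonempty ∧ (∀ z ∈ F, 0 < ι z) ∧
      ∀ z ∈ F, β * z ∈ Submodule.span ℕ (F : Set K) := by
  classical
  set φ₀ : K →+* ℂ := Complex.ofRealHom.comp ι with hφ₀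
  have hφ₀' (z : K) : φ₀ z = ι z := rfl
  obtain ⟨ρ, hρ0, hρ1, hρ⟩ : ∃ ρ : ℝ, 0 ≤ ρ ∧ ρ < 1 ∧
      ∀ φ : K →+* ℂ, φ β ≠ ι β → ‖φ β‖ ≤ ρ * ι β := by
    have : Nonempty (K →+* ℂ) := ⟨φ₀⟩
    obtain ⟨φ₁, h1⟩ := Finite.exists_max fun φ : K →+* ℂ =>
      if φ β = ι β then (0 : ℝ) else ‖φ β‖ / ι β
    refine ⟨if φ₁ β = ι β then (0 : ℝ) else ‖φ₁ β‖ / ι β, ?_, ?_, fun φ hφ => ?_⟩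
    · split_ifs
      exacts [le_rfl, by positivity]
    · split_ifs with h
      · exact one_pos
      · rw [div_lt_one hpos]
        exact (hdom φ₁).resolve_left h
    · have := h1 φ
      rw [if_neg hφ, div_le_iff₀ hpos] at this
      exact this
  obtain ⟨S, hS⟩ := hβ.fg_adjoin_singleton
  set B : ℝ := ∑ φ : K →+* ℂ, ∑ s ∈ S, ‖φ s‖ with hB
  have hB0 : 0 ≤ B := Finset.sum_nonneg fun _ _ => Finset.sum_nonneg fun _ _ => norm_nonneg _
  have hBφ (φ : K →+* ℂ) : ∑ s ∈ S, ‖φ s‖ ≤ B :=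
    Finset.single_le_sum (f := fun φ : K →+* ℂ => ∑ s ∈ S, ‖φ s‖)
      (fun _ _ => Finset.sum_nonneg fun _ _ => norm_nonneg _) (Finset.mem_univ φ)
  -- Large elements will be cut into parts of size `x` between `R / 3` and `R / 2`, up to an error
  -- `B`. The first condition keeps the parts positive and at most `R`; the second gives `ρ * x + B
  -- ≤ x - B`, so the parts still dominate their conjugates.
  obtain ⟨R, hR1, hRB⟩ : ∃ R : ℝ, 6 * B + 1 ≤ R ∧ 6 * B ≤ (1 - ρ) * R := by
    have h1 : 0 < 1 - ρ := by linarith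
    have h2 : (1 - ρ) * (6 * B / (1 - ρ)) = 6 * B := mul_div_cancel₀ _ h1.ne'
    have h3 : 6 * B ≤ 6 * B / (1 - ρ) := by
      rw [le_div_iff₀ h1]
      nlinarith
    exact ⟨6 * B / (1 - ρ) + 1, by linarith, by nlinarith⟩
  set E : Set K := {z | z ∈ adjoin ℤ {β} ∧ 0 < ι z ∧ ι z ≤ R ∧ ∀ φ : K →+* ℂ, ‖φ z‖ ≤ ι z} with hE
  have hEfin : E.Finite := by
    refine (NumberField.Embeddings.finite_of_norm_le K ℂ R).subset ?_
    rintro z ⟨hz, -, hzR, hzφ⟩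
    exact ⟨adjoin_le_integralClosure hβ hz, fun φ => (hzφ φ).trans hzR⟩
  -- Multiplication by `β` creates the gap `ρ`; the gap absorbs the rounding errors when `y` is cut
  -- into elements of the finite set `E`.
  have key (y : K) (hy : y ∈ adjoin ℤ {β}) (hy0 : 0 < ι y)
      (hyφ : ∀ φ : K →+* ℂ, φ β ≠ ι β → ‖φ y‖ ≤ ρ * ι y) : y ∈ Submodule.span ℕ E := by
    have hgood (z : K) (hz : z ∈ adjoin ℤ {β}) (hz0 : 0 < ι z) (hzR : ι z ≤ R)
        (hzφ : ∀ φ : K →+* ℂ, φ β ≠ ι β → ‖φ z‖ ≤ ι z) : z ∈ E := by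
      refine ⟨hz, hz0, hzR, fun φ => ?_⟩
      by_cases h : φ β = ι β
      · rw [map_eq_of_mem_adjoin h hz, Complex.norm_of_nonneg hz0.le]
      · exact hzφ φ h
    rcases le_or_gt (ι y) R with hle | hgt
    · exact Submodule.subset_span (hgood y hy hy0 hle fun φ h => (hyφ φ h).trans (by nlinarith))
    · have hR0 : 0 < R := by linarith
      set q : ℕ := ⌈2 * ι y / R⌉₊ with hqdef
      have hq0 : 0 < q := Nat.ceil_pos.2 (by positivity)
      have hqR : (0 : ℝ) < q := by exact_mod_cast hq0
      have hq1 : 2 * ι y ≤ q * R := by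
        rw [← div_le_iff₀ hR0]
        exact Nat.le_ceil _
      have hq2 : q * R ≤ 3 * ι y := by
        have : (q : ℝ) < 2 * ι y / R + 1 := Nat.ceil_lt_add_one (by positivity)
        have h2 : (2 * ι y / R + 1) * R = 2 * ι y + R := by field_simp
        nlinarith
      set x : ℝ := ι y / q with hx
      have hxq : x * q = ι y := div_mul_cancel₀ _ hqR.ne'
      have hx1 : x ≤ R / 2 := le_of_mul_le_mul_right (by linarith) hqR
      have hx2 : R / 3 ≤ x := le_of_mul_le_mul_right (by linarith) hqR
      obtain ⟨c, -, hc⟩ := Submodule.mem_span_finset.1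
        (hS.symm ▸ hy : y ∈ Submodule.span ℤ (S : Set K))
      obtain ⟨p, hpS, hpsum, hpφ⟩ := exists_near_equal_parts S c hq0
      rw [hc] at hpsum hpφ
      rw [← hpsum]
      refine Submodule.sum_mem _ fun i _ => Submodule.subset_span ?_
      have hpi : p i ∈ adjoin ℤ {β} := by
        have := hpS i
        rw [hS] at this
        exact this
      have hreal : |ι (p i) - x| ≤ B := by
        have := (hpφ φ₀ i).trans (hBφ φ₀)
        rw [hφ₀', hφ₀', ← Complex.ofReal_natCast, ← Complex.ofReal_div, ← Complex.ofReal_sub,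
          Complex.norm_real] at this
        exact this
      obtain ⟨hr1, hr2⟩ := abs_le.1 hreal
      refine hgood _ hpi (by linarith) (by linarith) fun φ h => ?_
      have h1 : ‖φ (p i)‖ ≤ ‖φ y‖ / q + B := by
        have h2 := (hpφ φ i).trans (hBφ φ)
        have h3 := norm_le_norm_add_norm_sub' (φ (p i)) (φ y / q)
        rw [norm_div, Complex.norm_natCast] at h3
        linarith
      have h2 : ‖φ y‖ / q ≤ ρ * x := by
        rw [hx, ← mul_div_assoc]
        gcongr
        exact hyφ φ h
      nlinarith
  refine ⟨hEfin.toFinset, ⟨1, ?_⟩, fun z hz => ?_, fun z hz => ?_⟩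
  · rw [Set.Finite.mem_toFinset]
    exact ⟨one_mem _, by simp, by simp; linarith, fun φ => by simp⟩
  · rw [Set.Finite.mem_toFinset] at hz
    exact hz.2.1
  · rw [Set.Finite.mem_toFinset] at hz
    rw [Set.Finite.coe_toFinset]
    refine key _ (mul_mem (self_mem_adjoin_singleton _ _) hz.1) ?_ fun φ hφ => ?_
    · rw [map_mul]
      exact mul_pos hpos hz.2.1
    · rw [map_mul, map_mul, norm_mul, ← mul_assoc]
      exact mul_le_mul (hρ φ hφ) (hz.2.2.2 φ) (norm_nonneg _) (by positivity)

end Semigroup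

open IntermediateField in
/-- A weak Perron number is the eigenvalue, for a positive eigenvector, of a nonnegative integer
matrix. -/
theorem IsWeakPerron.exists_matrix {l : ℝ} (hl : IsWeakPerron l) :
    ∃ (N : ℕ) (M : Fin N → Fin N → ℕ) (u : Fin N → ℝ), 1 ≤ N ∧ (∀ i, 0 < u i) ∧
      ∀ i, ∑ j, M i j * u j = l * u i := by
  classical
  obtain ⟨m, hm, hmpow⟩ := hl.exists_pow_eq
  obtain ⟨hl1, hint, hconj⟩ := hl
  have hl0 : 0 < l := by linarith
  have hfd := adjoin.finiteDimensional (K := ℚ) (hint.tower_top : IsIntegral ℚ l)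
  have : NumberField ℚ⟮l⟯ := {}
  let ι : ℚ⟮l⟯ →+* ℝ := algebraMap ℚ⟮l⟯ ℝ
  set g : ℚ⟮l⟯ := AdjoinSimple.gen ℚ l with hg
  have hιg : ι g = l := AdjoinSimple.coe_gen ℚ l
  have hgint : IsIntegral ℤ g := by
    rw [← isIntegral_algebraMap_iff (algebraMap ℚ⟮l⟯ ℝ).injective]
    exact hιg.symm ▸ hint
  obtain ⟨F, hF, hFpos, hFmul⟩ := exists_finset_mul_mem_span ι (β := g ^ m) (hgint.pow m)
    (by rw [map_pow, hιg]; positivity) (by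
      intro φ
      rw [map_pow, map_pow, hιg, norm_pow]
      have hroot : IsConjugateOf (φ g) l := by
        have h1 : Polynomial.aeval g (minpoly ℚ l) = 0 := by
          apply (algebraMap ℚ⟮l⟯ ℝ).injective
          rw [← Polynomial.aeval_algebraMap_apply, map_zero]
          exact hιg.symm ▸ minpoly.aeval ℚ l
        have h2 := Polynomial.aeval_algHom_apply φ.toRatAlgHom g (minpoly ℚ l)
        rw [h1, map_zero] at h2
        exact h2
      by_cases h : φ g = l
      · left
        rw [h]
        push_cast
        rfl
      · rcases (hconj _ hroot h).lt_or_eq with hlt | heq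
        · exact Or.inr (pow_lt_pow_left₀ hlt (norm_nonneg _) hm.ne')
        · left
          rw [hmpow _ hroot heq]
          push_cast
          rfl)
  -- The semigroup is stable under `l ^ m` only; adjoining the multiples by `l ^ t`, `t < m`, makes
  -- it stable under `l`.
  set U : Finset ℝ := (F ×ˢ Finset.range m).image fun x => l ^ x.2 * ι x.1 with hU
  have memU {z : ℚ⟮l⟯} (hz : z ∈ F) {t : ℕ} (ht : t < m) : l ^ t * ι z ∈ U :=
    Finset.mem_image.2 ⟨(z, t), Finset.mem_product.2 ⟨hz, Finset.mem_range.2 ht⟩, rfl⟩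
  have hUpos : ∀ u ∈ U, 0 < u := by
    intro u hu
    obtain ⟨⟨z, t⟩, hx, rfl⟩ := Finset.mem_image.1 hu
    have := hFpos z (Finset.mem_product.1 hx).1
    positivity
  have hUmul : ∀ u ∈ U, l * u ∈ Submodule.span ℕ (U : Set ℝ) := by
    intro u hu
    obtain ⟨⟨z, t⟩, hx, rfl⟩ := Finset.mem_image.1 hu
    obtain ⟨hz, ht⟩ := Finset.mem_product.1 hx
    rw [Finset.mem_range] at ht
    simp only at hz ht ⊢
    rw [← mul_assoc, ← pow_succ']
    rcases (Nat.succ_le_of_lt ht).lt_or_eq with hlt | heq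
    · exact Submodule.subset_span (memU hz hlt)
    · have h1 := Submodule.mem_map_of_mem (f := ι.toAddMonoidHom.toNatLinearMap) (hFmul z hz)
      rw [Submodule.map_span] at h1
      have h2 : ι.toAddMonoidHom.toNatLinearMap (g ^ m * z) = l ^ (t + 1) * ι z := by
        change ι (g ^ m * z) = _
        rw [map_mul, map_pow, hιg, ← heq]
      rw [h2] at h1
      refine Submodule.span_mono ?_ h1
      rintro _ ⟨y, hy, rfl⟩
      have := memU hy hm
      rw [pow_zero, one_mul] at this
      exact this
  have hUne : U.Nonempty := by
    obtain ⟨z, hz⟩ := hF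
    exact ⟨_, memU hz hm⟩
  have hcoef (u : U) : ∃ f : ℝ → ℕ, ∑ a ∈ U, f a • a = l * u := by
    obtain ⟨f, -, hf⟩ := Submodule.mem_span_finset.1 (hUmul u u.2)
    exact ⟨f, hf⟩
  choose f hf using hcoef
  refine ⟨U.card, fun i j => f (U.equivFin.symm i) (U.equivFin.symm j),
    fun i => U.equivFin.symm i, Finset.card_pos.2 hUne, fun i => hUpos _ (U.equivFin.symm i).2,
    fun i => ?_⟩
  rw [← hf, ← Finset.sum_coe_sort U, ← U.equivFin.symm.sum_comp]
  simp

end AffineDyn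

/-! ### Least dimensions for integers and quadratic integers. -/

namespace AffineDyn

open Polynomial

variable {k : Type*} [Field k]

theorem IsWeakPerron.realizingDims_nonempty {l : ℝ} (hl : IsWeakPerron l) :
    (realizingDims k l).Nonempty := by
  rcases hl.1.eq_or_lt with rfl | h1
  · exact ⟨1, one_mem_realizingDims⟩
  · obtain ⟨N, M, u, hN, hu, hM⟩ := hl.exists_matrix
    exact ⟨_, add_self_mem_realizingDims hN h1 M hu hM⟩

theorem two_le_of_mem_realizingDims {l : ℝ} (h1 : 1 < l) {n : ℕ} (hn : n ∈ realizingDims k l) :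
    2 ≤ n := by
  obtain ⟨hn1, f, hf, hf', hd⟩ := hn
  by_contra hlt
  obtain rfl : n = 1 := by omega
  exact absurd (PolyEnd.dynamicalDegree_le_one_of_dim_one hd hf hf') (not_le.2 h1)

theorem three_le_of_mem_realizingDims {l : ℝ} (h1 : 1 < l) (hl : ∀ D : ℕ, l ≠ D) {n : ℕ}
    (hn : n ∈ realizingDims k l) : 3 ≤ n := by
  have h2 := two_le_of_mem_realizingDims h1 hn
  obtain ⟨-, f, hf, hf', hd⟩ := hn
  by_contra hlt
  obtain rfl : n = 2 := by omega
  obtain ⟨D, hD⟩ := PolyEnd.dynamicalDegree_of_dim_two hd hf hf' h1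
  exact hl D hD

theorem four_le_of_mem_realizingDims {l : ℝ} (h1 : 1 < l) (hl : ∀ D : ℕ, l ≠ D)
    (hl' : ∀ i j : ℕ, l ^ 2 ≠ i * l + j) {n : ℕ} (hn : n ∈ realizingDims k l) : 4 ≤ n := by
  have h3 := three_le_of_mem_realizingDims h1 hl hn
  obtain ⟨-, f, hf, hf', hd⟩ := hn
  by_contra hlt
  obtain rfl : n = 3 := by omega
  obtain ⟨i, j, hij⟩ := PolyEnd.dynamicalDegree_of_dim_three hd hf hf' h1
  exact hl' i j hij

theorem IsQuadraticInteger.ne_natCast {l : ℝ} (hl : IsQuadraticInteger l) (D : ℕ) : l ≠ D := by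
  rintro rfl
  have h2 := hl.2
  have : minpoly ℚ ((D : ℚ) : ℝ) = X - C (D : ℚ) := minpoly.eq_X_sub_C ℝ (D : ℚ)
  rw [Rat.cast_natCast] at this
  rw [this, natDegree_X_sub_C] at h2
  omega

theorem IsQuadraticInteger.exists_trace_norm {l : ℝ} (hl : IsQuadraticInteger l) {μ : ℝ}
    (hμ : IsConjugateOf (μ : ℂ) l) (hne : μ ≠ l) :
    ∃ a c : ℤ, l + μ = a ∧ l * μ = c := by
  have hroot : aeval μ (minpoly ℚ l) = 0 := by
    have h1 : aeval (μ : ℂ) (minpoly ℚ l) = algebraMap ℝ ℂ (aeval μ (minpoly ℚ l)) :=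
      aeval_algebraMap_apply ℂ μ _
    rw [IsConjugateOf, h1] at hμ
    exact (map_eq_zero _).1 hμ
  have hmap : minpoly ℚ l = (minpoly ℤ l).map (algebraMap ℤ ℚ) :=
    minpoly.isIntegrallyClosed_eq_field_fractions' ℚ hl.1
  have hmonic := minpoly.monic hl.1
  have hdeg : (minpoly ℤ l).natDegree = 2 := by
    rw [← hl.2, hmap, hmonic.natDegree_map]
  have eq (x : ℝ) (hx : aeval x (minpoly ℚ l) = 0) :
      x ^ 2 + (minpoly ℤ l).coeff 1 * x + (minpoly ℤ l).coeff 0 = 0 := by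
    rw [hmap, aeval_map_algebraMap, aeval_eq_sum_range, hdeg] at hx
    simp only [Finset.sum_range_succ, Finset.sum_range_zero, zsmul_eq_mul, zero_add] at hx
    have hlc : (minpoly ℤ l).coeff 2 = 1 := by
      rw [← hdeg]
      exact hmonic
    rw [hlc] at hx
    push_cast at hx
    linarith
  have e1 := eq l (minpoly.aeval ℚ l)
  have e2 := eq μ hroot
  have hsum : l + μ = -(minpoly ℤ l).coeff 1 := by
    have : (l - μ) * (l + μ + (minpoly ℤ l).coeff 1) = 0 := by linear_combination e1 - e2
    rcases mul_eq_zero.1 this with h | h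
    · exact absurd (sub_eq_zero.1 h).symm hne
    · linarith
  refine ⟨-(minpoly ℤ l).coeff 1, (minpoly ℤ l).coeff 0, by push_cast; exact hsum, ?_⟩
  linear_combination l * hsum - e1

/-- The conjugate `μ` satisfies the same equation, so `l` and `μ` are its two roots and their
product is `-j`. -/
theorem mul_nonpos_of_sq_eq {l μ : ℝ} (hμ : IsConjugateOf (μ : ℂ) l) (hne : μ ≠ l) {i j : ℕ}
    (h : l ^ 2 = i * l + j) : l * μ ≤ 0 := by
  have hdvd : minpoly ℚ l ∣ X ^ 2 - C (i : ℚ) * X - C (j : ℚ) := by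
    refine minpoly.dvd ℚ l ?_
    simp
    linarith
  have h2 : aeval (μ : ℂ) (X ^ 2 - C (i : ℚ) * X - C (j : ℚ)) = 0 :=
    aeval_eq_zero_of_dvd_aeval_eq_zero hdvd hμ
  have h3 : μ ^ 2 = i * μ + j := by
    simp at h2
    have h4 : ((μ ^ 2 - i * μ - j : ℝ) : ℂ) = 0 := by
      push_cast
      exact h2
    have := Complex.ofReal_eq_zero.1 h4
    linarith
  have hsum : l + μ = i := by
    have : (l - μ) * (l + μ - i) = 0 := by linear_combination h - h3
    rcases mul_eq_zero.1 this with h | h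
    · exact absurd (sub_eq_zero.1 h).symm hne
    · linarith
  have : l * μ = -j := by linear_combination l * hsum - h
  rw [this]
  exact neg_nonpos.2 (Nat.cast_nonneg j)

theorem four_mem_realizingDims {l μ : ℝ} (hl : 1 < l) (hμ : 0 < μ) (hμl : μ < l) {a c : ℤ}
    (ha : l + μ = a) (hc : l * μ = c) : 4 ∈ realizingDims k l := by
  have ha0 : 0 < a := by
    have : (0 : ℝ) < a := by rw [← ha]; linarith
    exact_mod_cast this
  have hdisc : 4 * c + 1 ≤ a ^ 2 := by
    have : (4 * c : ℝ) < a ^ 2 := by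
      rw [← ha, ← hc]
      nlinarith [mul_pos (sub_pos.2 hμl) (sub_pos.2 hμl)]
    have : 4 * c < a ^ 2 := by exact_mod_cast this
    omega
  -- Splitting the trace `a` into nearly equal halves makes `p * s` as large as possible, the
  -- integer part of `a ^ 2 / 4`. It is at least the norm `c` since the discriminant is positive.
  obtain ⟨p, s, hps, hps'⟩ : ∃ p s : ℕ, (p + s : ℤ) = a ∧ (s = p ∨ s = p + 1) :=
    ⟨(a / 2).toNat, (a - a / 2).toNat, by omega, by omega⟩
  have hcps : c ≤ p * s := by
    rcases hps' with rfl | rfl <;> push_cast at hps ⊢ <;> subst hps <;> nlinarith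
  obtain ⟨r, hr⟩ := Int.eq_ofNat_of_zero_le (sub_nonneg.2 hcps)
  have hrR : (p * s - c : ℝ) = r := by exact_mod_cast hr
  have haR : (p + s : ℝ) = a := by exact_mod_cast hps
  have hpl : 0 < l - p := by
    have : (p : ℝ) ≤ s := by
      rcases hps' with rfl | rfl <;> push_cast <;> linarith
    linarith
  -- With `r = p * s - c` this matrix has trace `a` and determinant `c`; its eigenvector `(1, l -
  -- p)` is positive because `p ≤ a / 2 < l`.
  refine add_self_mem_realizingDims (N := 2) (by norm_num) hl ![![p, 1], ![r, s]]
    (u := ![1, l - p]) (fun i => ?_) fun i => ?_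
  · fin_cases i
    · exact one_pos
    · exact hpl
  · fin_cases i
    · simp
    · simp
      rw [← hrR]
      linear_combination l * haR - l * ha + hc

end AffineDyn

theorem theorem2 {k : Type*} [Field k] (l : ℝ) (hl : AffineDyn.IsWeakPerron l) :
    (AffineDyn.realizingDims k l).Nonempty ∧
    (1 < l → (∃ m : ℤ, l = (m : ℝ)) → IsLeast (AffineDyn.realizingDims k l) 2) ∧
    (AffineDyn.IsQuadraticInteger l →
      ∀ μ : ℝ, AffineDyn.IsConjugateOf (μ : ℂ) l → μ ≠ l →
        (μ < 0 → IsLeast (AffineDyn.realizingDims k l) 3) ∧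
        (0 < μ → IsLeast (AffineDyn.realizingDims k l) 4)) := by
  refine ⟨hl.realizingDims_nonempty, ?_, ?_⟩
  · rintro h1 ⟨m, rfl⟩
    refine ⟨?_, fun n hn => AffineDyn.two_le_of_mem_realizingDims h1 hn⟩
    have hm : 1 < m := by exact_mod_cast h1
    obtain ⟨D, rfl⟩ := Int.eq_ofNat_of_zero_le (by omega : 0 ≤ m)
    have := AffineDyn.two_mem_realizingDims (k := k) (D := D) (by omega)
    simpa using this
  · intro hq μ hμ hne
    have h1 : 1 < l := lt_of_le_of_ne hl.1 fun h => hq.ne_natCast 1 (by rw [← h]; simp)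
    have habs : |μ| ≤ l := by
      have := hl.2.2 μ hμ (by exact_mod_cast hne)
      rwa [Complex.norm_real] at this
    obtain ⟨a, c, ha, hc⟩ := hq.exists_trace_norm hμ hne
    refine ⟨fun hneg => ⟨?_, fun n hn => ?_⟩, fun hpos => ⟨?_, fun n hn => ?_⟩⟩
    -- The weak Perron condition makes the trace `a` nonnegative and `μ < 0` makes the norm `c`
    -- negative, so `l ^ 2 = a * l - c` has natural coefficients.
    · have ha0 : 0 ≤ a := by
        have : (0 : ℝ) ≤ a := by rw [← ha]; linarith [neg_abs_le μ]
        exact_mod_cast this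
      have hc0 : 0 ≤ -c := by
        have : (c : ℝ) < 0 := by rw [← hc]; nlinarith
        have : c < 0 := by exact_mod_cast this
        omega
      obtain ⟨a', rfl⟩ := Int.eq_ofNat_of_zero_le ha0
      obtain ⟨b, hb⟩ := Int.eq_ofNat_of_zero_le hc0
      have hbR : -(c : ℝ) = b := by exact_mod_cast hb
      refine AffineDyn.three_mem_realizingDims h1 (a := a') (b := b) ?_
      rw [← hbR]
      push_cast at ha
      linear_combination l * ha - hc
    · exact AffineDyn.three_le_of_mem_realizingDims h1 hq.ne_natCast hn
    · exact AffineDyn.four_mem_realizingDims h1 hpos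
        (lt_of_le_of_ne ((le_abs_self μ).trans habs) hne) ha hc
    · refine AffineDyn.four_le_of_mem_realizingDims h1 hq.ne_natCast (fun i j hij => ?_) hn
      have := AffineDyn.mul_nonpos_of_sq_eq hμ hne hij
      nlinarith
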